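/- Let $n,m,d,k$ be nonnegative integers with $k\le\min(n,m)$, let $\Omega\subseteq[n]\times[m]$, $A\in\mathbb{R}^{n\times m}$ (only the entries in $\Omega$ are used), $Y\in\mathbb{R}^{n\times d}$, and $\lambda,\gamma,\rho_1,\rho_2>0$. Let $\mathcal{P}_k=\{P\in\mathbb{R}^{n\times n}: P^T=P,\ P^2=P,\ \operatorname{Tr}(P)\le k\}$, and let $\mathbb{I}_{\mathcal{P}_k}(P)$ be $0$ if $P\in\mathcal{P}_k$ and $\infty$ otherwise. For $U,Z\in\mathbb{R}^{n\times k}$, $V\in\mathbb{R}^{m\times k}$, $P\in\mathbb{R}^{n\times n}$ consider the split problem $$\min_{U,Z,V,P}\ \sum_{(i,j)\in\Omega}((UV^T)_{ij}-A_{ij})^2+\lambda\operatorname{Tr}(Y^T(I_n-P)Y)+\tfrac{\gamma}{2}(\|U\|_F^2+\|V\|_F^2)+\mathbb{I}_{\mathcal{P}_k}(P)\quad\text{s.t. }(I_n-P)Z=0,\ U-Z=0,$$ and, for $\Phi,\Psi\in\mathbb{R}^{n\times k}$, its augmented Lagrangian $$\mathcal{L}^A=\sum_{(i,j)\in\Omega}((UV^T)_{ij}-A_{ij})^2+\lambda\operatorname{Tr}(Y^T(I_n-P)Y)+\tfrac{\gamma}{2}(\|U\|_F^2+\|V\|_F^2)+\mathbb{I}_{\mathcal{P}_k}(P)+\operatorname{Tr}(\Phi^T(I_n-P)Z)+\operatorname{Tr}(\Psi^T(Z-U))+\tfrac{\rho_1}{2}\|(I_n-P)Z\|_F^2+\tfrac{\rho_2}{2}\|Z-U\|_F^2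 .$$ Algorithm (Mixed-Projection ADMM, run forever). Let $L\Sigma R^T$, with $L\in\mathbb{R}^{n\times k}$ and $R\in\mathbb{R}^{m\times k}$ having orthonormal columns, be a rank $k$ truncated singular value decomposition of $A$ with the entries outside $\Omega$ replaced by $0$. Put $U_0=Z_0=L\Sigma^{1/2}$, $V_0=R\Sigma^{1/2}$, $P_0=LL^T$, let all entries of $\Phi_0,\Psi_0$ be $1$, and for $t=0,1,2,\dots$ let - $(U_{t+1},P_{t+1})$ be a minimizer over $(U,P)$ of $\mathcal{L}^A(U,V_t,P,Z_t,\Phi_t,\Psi_t)$, - $(V_{t+1},Z_{t+1})$ be a minimizer over $(V,Z)$ of $\mathcal{L}^A(U_{t+1},V,P_{t+1},Z,\Phi_t,\Psi_t)$, - $\Phi_{t+1}=\Phi_t+\rho_1(I_n-P_{t+1})Z_{t+1}$ and $\Psi_{t+1}=\Psi_t+\rho_2(Z_{t+1}-U_{t+1})$. Theorem. Let $(U_t,V_t,P_t,Z_t,\Phi_t,\Psi_t)_{t\ge0}$ be a sequence generated in this way. Suppose that $(\Phi_t,\Psi_t)$ is bounded and $\sum_{t=0}^\infty(\|\Phi_{t+1}-\Phi_t\|_F^2+\|\Psi_{t+1}-\Psi_t\|_F^2)<\infty$.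 Let $(\bar U,\bar V,\bar P,\bar Z,\bar\Phi,\bar\Psi)$ be any accumulation point of the sequence, and put $B=\lambda YY^T+\tfrac12(\bar\Phi\bar Z^T+\bar Z\bar\Phi^T)$. Suppose that the $k$ leading eigenvectors of $B$ agree with those of $\bar Z\bar Z^T$, in the sense that some choice of $k$ orthonormal eigenvectors of $B$ for its $k$ largest eigenvalues spans the same subspace as some choice of $k$ orthonormal eigenvectors of $\bar Z\bar Z^T$ for its $k$ largest eigenvalues. Then the accumulation point satisfies the first order optimality conditions of the split problem, that is (omitting bars, with $X_{i,\star}$ and $X_{\star,j}$ the $i$-th row and the $j$-th column of $X$ as column vectors, $W_i$ the diagonal matrix with $(W_i)_{jj}=1$ if $(i,j)\in\Omega$ and $0$ otherwise, and $W'_j$ the diagonal matrix with $(W'_j)_{ii}=1$ if $(i,j)\in\Omega$ and $0$ otherwise): 1. $[2V^TW_iV+\gamma I_k]U_{i,\star}=2V^TW_iA_{i,\star}+\Psi_{i,\star}$ for all $i\in[n]$; 2. $[2U^TW'_jU+\gamma I_k]V_{j,\star}=2U^TW'_jA_{\star,j}$ for all $j\in[m]$; 3. there are $M\in\mathbb{R}^{n\times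 k}$ with $M^TM=I_k$ and $\Sigma=\operatorname{diag}(\sigma_1,\dots,\sigma_k)$ such that $M\Sigma M^T$ is a rank $k$ truncated singular value decomposition of $B$ (that is, $BM=M\Sigma$ and every $\sigma_i$ is at least the absolute value of every eigenvalue of $B$ on the orthogonal complement of the columns of $M$; if $k<n$ this forces $\sigma_i\ge 0$, while if $k=n$ it is a full spectral decomposition of $B$), and $P=\sum_{i\in S}M_{\star,i}M_{\star,i}^T$ for a set $S\subseteq[k]$ containing every $i$ with $\sigma_i\neq0$. In particular $P=MM^T$ whenever $P$ has rank $k$ or all $\sigma_i$ are nonzero; 4. $\Phi+\Psi=P\Phi$; 5. $Z=PZ$; 6. $Z=U$. -/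

import Mathlib

open Matrix Filter

namespace MixedProjectionADMM

variable {n m d k : ℕ}

/-- Squared Frobenius norm. -/
def frobSq {a b : ℕ} (X : Matrix (Fin a) (Fin b) ℝ) : ℝ := ∑ i, ∑ j, X i j ^ 2

/-- The set of orthogonal projection matrices of trace (equivalently, rank) at most `k`. -/
def projSet (n k : ℕ) : Set (Matrix (Fin n) (Fin n) ℝ) :=
  {P | Pᵀ = P ∧ P * P = P ∧ P.trace ≤ (k : ℝ)}

/-- The augmented Lagrangian, without the indicator function of `projSet n k`; that indicator
is accounted for by minimizing over `P ∈ projSet n k` only. -/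
noncomputable def augLagrangian (Ω : Finset (Fin n × Fin m)) (A : Matrix (Fin n) (Fin m) ℝ)
    (Y : Matrix (Fin n) (Fin d) ℝ) (lam gam ρ₁ ρ₂ : ℝ)
    (U : Matrix (Fin n) (Fin k) ℝ) (V : Matrix (Fin m) (Fin k) ℝ)
    (P : Matrix (Fin n) (Fin n) ℝ) (Z Φ Ψ : Matrix (Fin n) (Fin k) ℝ) : ℝ :=
  ∑ e ∈ Ω, ((U * Vᵀ) e.1 e.2 - A e.1 e.2) ^ 2
    + lam * (Yᵀ * (1 - P) * Y).trace
    + gam / 2 * (frobSq U + frobSq V)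
    + (Φᵀ * (1 - P) * Z).trace
    + (Ψᵀ * (Z - U)).trace
    + ρ₁ / 2 * frobSq ((1 - P) * Z)
    + ρ₂ / 2 * frobSq (Z - U)

/-- The observed entries of `A`, the missing ones being filled in with `0`. -/
def zeroFill (Ω : Finset (Fin n × Fin m)) (A : Matrix (Fin n) (Fin m) ℝ) :
    Matrix (Fin n) (Fin m) ℝ :=
  Matrix.of fun i j => if (i, j) ∈ Ω then A i j else 0

/-- `L * diagonal s * Rᵀ` is a rank `k` truncated singular value decomposition of `X`:
the columns of `L` and `R` are orthonormal left and right singular vectors for the singular values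
`s 0 ≥ s 1 ≥ ⋯ ≥ 0`, and no remaining singular value exceeds any of these. -/
structure IsTruncatedSVD (X : Matrix (Fin n) (Fin m) ℝ) (L : Matrix (Fin n) (Fin k) ℝ)
    (s : Fin k → ℝ) (R : Matrix (Fin m) (Fin k) ℝ) : Prop where
  left_orthonormal : Lᵀ * L = 1
  right_orthonormal : Rᵀ * R = 1
  nonneg : ∀ i, 0 ≤ s i
  antitone : Antitone s
  mul_right : X * R = L * diagonal s
  mul_left : Xᵀ * L = R * diagonal s
  leading : ∀ (i : Fin k) (x : Fin m → ℝ), Rᵀ *ᵥ x = 0 →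
    (X *ᵥ x) ⬝ᵥ (X *ᵥ x) ≤ s i ^ 2 * (x ⬝ᵥ x)

/-- The sequences are generated by the algorithm, iterating indefinitely. -/
structure IsRun (Ω : Finset (Fin n × Fin m)) (A : Matrix (Fin n) (Fin m) ℝ)
    (Y : Matrix (Fin n) (Fin d) ℝ) (lam gam ρ₁ ρ₂ : ℝ)
    (U : ℕ → Matrix (Fin n) (Fin k) ℝ) (V : ℕ → Matrix (Fin m) (Fin k) ℝ)
    (P : ℕ → Matrix (Fin n) (Fin n) ℝ) (Z Φ Ψ : ℕ → Matrix (Fin n) (Fin k) ℝ) : Prop where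
  /-- Initialization of the primal iterates. -/
  init_primal : ∃ (L : Matrix (Fin n) (Fin k) ℝ) (s : Fin k → ℝ) (R : Matrix (Fin m) (Fin k) ℝ),
    IsTruncatedSVD (zeroFill Ω A) L s R ∧
    U 0 = L * diagonal (fun i => √(s i)) ∧ P 0 = L * Lᵀ ∧
    V 0 = R * diagonal (fun i => √(s i)) ∧ Z 0 = L * diagonal (fun i => √(s i))
  init_Φ : Φ 0 = Matrix.of fun _ _ => 1
  init_Ψ : Ψ 0 = Matrix.of fun _ _ => 1
  /-- `(U (t+1), P (t+1))` minimizes the augmented Lagrangian in the variables `(U, P)`. -/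
  step_UP : ∀ t, P (t + 1) ∈ projSet n k ∧
    ∀ (U' : Matrix (Fin n) (Fin k) ℝ), ∀ P' ∈ projSet n k,
      augLagrangian Ω A Y lam gam ρ₁ ρ₂ (U (t + 1)) (V t) (P (t + 1)) (Z t) (Φ t) (Ψ t) ≤
        augLagrangian Ω A Y lam gam ρ₁ ρ₂ U' (V t) P' (Z t) (Φ t) (Ψ t)
  /-- `(V (t+1), Z (t+1))` minimizes the augmented Lagrangian in the variables `(V, Z)`. -/
  step_VZ : ∀ t, ∀ (V' : Matrix (Fin m) (Fin k) ℝ) (Z' : Matrix (Fin n) (Fin k) ℝ),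
    augLagrangian Ω A Y lam gam ρ₁ ρ₂ (U (t + 1)) (V (t + 1)) (P (t + 1)) (Z (t + 1))
        (Φ t) (Ψ t) ≤
      augLagrangian Ω A Y lam gam ρ₁ ρ₂ (U (t + 1)) V' (P (t + 1)) Z' (Φ t) (Ψ t)
  step_Φ : ∀ t, Φ (t + 1) = Φ t + ρ₁ • ((1 - P (t + 1)) * Z (t + 1))
  step_Ψ : ∀ t, Ψ (t + 1) = Ψ t + ρ₂ • (Z (t + 1) - U (t + 1))

/-- The columns of `M` are `k` leading eigenvectors of the symmetric matrix `C`: they are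
orthonormal eigenvectors, and no eigenvalue of `C` on their orthogonal complement exceeds any of
their eigenvalues. -/
def IsLeadingEigenvectors (C : Matrix (Fin n) (Fin n) ℝ) (M : Matrix (Fin n) (Fin k) ℝ) : Prop :=
  Mᵀ * M = 1 ∧ ∃ σ : Fin k → ℝ, C * M = M * diagonal σ ∧
    ∀ (i : Fin k) (x : Fin n → ℝ), Mᵀ *ᵥ x = 0 → x ⬝ᵥ (C *ᵥ x) ≤ σ i * (x ⬝ᵥ x)

/-- The column space. -/
def colSpace (M : Matrix (Fin n) (Fin k) ℝ) : Submodule ℝ (Fin n → ℝ) :=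
  Submodule.span ℝ (Set.range Mᵀ)

/-- `M * diagonal σ * Mᵀ` is a rank `k` truncated singular value decomposition of the symmetric
matrix `C`: orthonormal eigenvectors whose eigenvalues are at least the absolute value of every
eigenvalue on the orthogonal complement. For `k < n` this forces `σ ≥ 0`; for `k = n` it is a full
spectral decomposition of `C`, in which negative eigenvalues are allowed. -/
structure IsSymTruncatedSVD (C : Matrix (Fin n) (Fin n) ℝ) (M : Matrix (Fin n) (Fin k) ℝ)
    (σ : Fin k → ℝ) : Prop where
  orthonormal : Mᵀ * M = 1
  eigen : C * M = M * diagonal σ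
  leading : ∀ (i : Fin k) (x : Fin n → ℝ), Mᵀ *ᵥ x = 0 → |x ⬝ᵥ (C *ᵥ x)| ≤ σ i * (x ⬝ᵥ x)

/-- The matrix `λ Y Yᵀ + ½ (Φ Zᵀ + Z Φᵀ)`. -/
noncomputable def dualMatrix (Y : Matrix (Fin n) (Fin d) ℝ) (lam : ℝ)
    (Z Φ : Matrix (Fin n) (Fin k) ℝ) : Matrix (Fin n) (Fin n) ℝ :=
  lam • (Y * Yᵀ) + (1 / 2 : ℝ) • (Φ * Zᵀ + Z * Φᵀ)

/-- The diagonal `0/1` matrix of the observed entries in row `i`. -/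
def rowMask (Ω : Finset (Fin n × Fin m)) (i : Fin n) : Matrix (Fin m) (Fin m) ℝ :=
  diagonal fun j => if (i, j) ∈ Ω then 1 else 0

/-- The diagonal `0/1` matrix of the observed entries in column `j`. -/
def colMask (Ω : Finset (Fin n × Fin m)) (j : Fin m) : Matrix (Fin n) (Fin n) ℝ :=
  diagonal fun i => if (i, j) ∈ Ω then 1 else 0

/-- The first order optimality conditions of the split problem. -/
structure FirstOrderOptimal (Ω : Finset (Fin n × Fin m)) (A : Matrix (Fin n) (Fin m) ℝ)
    (Y : Matrix (Fin n) (Fin d) ℝ) (lam gam : ℝ)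
    (U : Matrix (Fin n) (Fin k) ℝ) (V : Matrix (Fin m) (Fin k) ℝ)
    (P : Matrix (Fin n) (Fin n) ℝ) (Z Φ Ψ : Matrix (Fin n) (Fin k) ℝ) : Prop where
  cond_U : ∀ i : Fin n,
    ((2 : ℝ) • (Vᵀ * rowMask Ω i * V) + gam • (1 : Matrix (Fin k) (Fin k) ℝ)) *ᵥ U.row i =
      (2 : ℝ) • ((Vᵀ * rowMask Ω i) *ᵥ A.row i) + Ψ.row i
  cond_V : ∀ j : Fin m,
    ((2 : ℝ) • (Uᵀ * colMask Ω j * U) + gam • (1 : Matrix (Fin k) (Fin k) ℝ)) *ᵥ V.row j =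
      (2 : ℝ) • ((Uᵀ * colMask Ω j) *ᵥ A.col j)
  /-- `P` is the projection `M * Mᵀ` given by a rank `k` truncated singular value decomposition
  `M * diagonal σ * Mᵀ`, where columns of `M` that belong to a zero singular value may be left out
  (the constraint on `P` being that its trace is at most `k`). In particular `P = M * Mᵀ` if `P`
  has rank `k`. -/
  cond_P : ∃ (M : Matrix (Fin n) (Fin k) ℝ) (σ : Fin k → ℝ) (S : Finset (Fin k)),
    IsSymTruncatedSVD (dualMatrix Y lam Z Φ) M σ ∧ (∀ i, σ i ≠ 0 → i ∈ S) ∧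
    P = M * diagonal (fun i => if i ∈ S then (1 : ℝ) else 0) * Mᵀ
  cond_Z : Φ + Ψ = P * Φ
  cond_Φ : Z = P * Z
  cond_Ψ : Z = U

end MixedProjectionADMM

/-!
The residuals of the two constraints are the dual increments divided by `ρ₁` and `ρ₂`, so they tend
to zero and every accumulation point is feasible. The difficulty is that the subproblem solved for
`(U (t + 1), P (t + 1))` involves `V t` and `Z t`, so its optimality condition passes to a limit
only if consecutive iterates approach each other. For `Φ` and `Ψ` this is assumed. For `V` and `Z`
it follows from a descent argument: the augmented Lagrangian is strongly convex in `(V, Z)`, so each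
iteration lowers it by a multiple of the squared step length (`IsRun.sufficient_decrease`), up to
the summable amount that the dual update adds; since it is bounded below for bounded duals, the
squared steps are summable (`IsRun.tendsto_primal_diff`). In the limit
(`IsRun.stationary_of_mapClusterPt`) the directional derivatives in `U`, `V`, `Z` vanish, which are
three of the conditions, and `P` minimizes its own subproblem over the projections of trace at most
`k`. For projections the objective of that subproblem is linear, so `P` maximizes the trace of
`P * (B + (ρ₁ / 2) • (Z * Zᵀ))`, where `B` is the dual matrix.

The remaining condition says that `P` is a leading spectral projection of `B` alone. Let `Q` be the
projection onto the common leading eigenspace of `B` and `Z * Zᵀ`. As `Z * Zᵀ` has rank at most `k`,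
`Q` fixes `Z`, and so does `P` by feasibility; comparing `P` with `Q` therefore gives
`tr (Q * B) ≤ tr (P * B)`. On the kernels of `P` and of `Q` the form of `B` reduces to that of
`λ Y Yᵀ`, so it is nonnegative there. If `k < n`, the leading eigenvalues of `B` are therefore
nonnegative, and Ky Fan's inequality (`trace_mul_le_sum_of_leading`) shows that `P` maximizes
`tr (P * B)`. Exchanging single lines between range and kernel of a maximizer shows that it commutes
with the matrix and that Rayleigh quotients on its kernel do not exceed those on its range
(`form_range_ker_eq_zero`, `form_ker_le_form_range`); if its trace is less than `k`, adding a line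
shows that the form is nonpositive, hence zero, on the kernel. Diagonalizing `B` on the range of `P`
and filling up with vectors of the kernel gives the decomposition (`exists_symTruncatedSVD`). If
`k = n` there is no orthogonal complement to control, and the same exchange argument applied to
`B + (ρ₁ / 2) • (Z * Zᵀ)` suffices, since `Z` vanishes on the kernel of `P`.
-/

open scoped Topology

namespace MixedProjectionADMM

variable {n m d k : ℕ}

/-! ### The Frobenius norm -/

theorem frobSq_eq_trace {a b : ℕ} (X : Matrix (Fin a) (Fin b) ℝ) :
    frobSq X = (Xᵀ * X).trace := by
  simp only [frobSq, trace, diag_apply, mul_apply, transpose_apply]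
  rw [Finset.sum_comm]
  simp only [sq]

theorem frobSq_nonneg {a b : ℕ} (X : Matrix (Fin a) (Fin b) ℝ) : 0 ≤ frobSq X :=
  Finset.sum_nonneg fun _ _ => Finset.sum_nonneg fun _ _ => sq_nonneg _

theorem sq_apply_le_frobSq {a b : ℕ} (X : Matrix (Fin a) (Fin b) ℝ) (i : Fin a) (j : Fin b) :
    X i j ^ 2 ≤ frobSq X :=
  (Finset.single_le_sum (f := fun j => X i j ^ 2) (fun _ _ => sq_nonneg _)
    (Finset.mem_univ j)).trans
    (Finset.single_le_sum (f := fun i => ∑ j, X i j ^ 2)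
      (fun _ _ => Finset.sum_nonneg fun _ _ => sq_nonneg _) (Finset.mem_univ i))

theorem eq_zero_of_frobSq_eq_zero {a b : ℕ} {X : Matrix (Fin a) (Fin b) ℝ} (h : frobSq X = 0) :
    X = 0 := by
  ext i j
  have := sq_apply_le_frobSq X i j
  rw [h] at this
  exact pow_eq_zero_iff two_ne_zero |>.1 (le_antisymm this (sq_nonneg _))

theorem trace_transpose_mul_comm {a b : ℕ} (X H : Matrix (Fin a) (Fin b) ℝ) :
    (Hᵀ * X).trace = (Xᵀ * H).trace := by
  rw [← trace_transpose (Xᵀ * H), transpose_mul, transpose_transpose]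

theorem frobSq_add_smul {a b : ℕ} (X H : Matrix (Fin a) (Fin b) ℝ) (s : ℝ) :
    frobSq (X + s • H) = frobSq X + s * (2 * (Xᵀ * H).trace) + s ^ 2 * frobSq H := by
  simp only [frobSq_eq_trace, transpose_add, transpose_smul, Matrix.add_mul, Matrix.mul_add,
    Matrix.smul_mul,
    Matrix.mul_smul, trace_add, trace_smul, smul_eq_mul]
  rw [trace_transpose_mul_comm X H]
  ring

theorem frobSq_smul {a b : ℕ} (X : Matrix (Fin a) (Fin b) ℝ) (s : ℝ) :
    frobSq (s • X) = s ^ 2 * frobSq X := by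
  simp [frobSq, mul_pow, Finset.mul_sum]

theorem frobSq_sub_comm {a b : ℕ} (X H : Matrix (Fin a) (Fin b) ℝ) :
    frobSq (X - H) = frobSq (H - X) := by
  rw [← neg_sub, ← neg_one_smul ℝ, frobSq_smul]; norm_num

/-- Young's inequality for the Frobenius inner product. -/
theorem neg_frobSq_div_le {a b : ℕ} (X W : Matrix (Fin a) (Fin b) ℝ) {ρ : ℝ} (hρ : 0 < ρ) :
    -(frobSq X / (2 * ρ)) ≤ (Xᵀ * W).trace + ρ / 2 * frobSq W := by
  have h := frobSq_nonneg (X + ρ • W)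
  rw [frobSq_add_smul] at h
  have : (Xᵀ * W).trace + ρ / 2 * frobSq W + frobSq X / (2 * ρ) =
      (frobSq X + ρ * (2 * (Xᵀ * W).trace) + ρ ^ 2 * frobSq W) / (2 * ρ) := by
    field_simp; ring
  have h2 : 0 ≤ (frobSq X + ρ * (2 * (Xᵀ * W).trace) + ρ ^ 2 * frobSq W) / (2 * ρ) := by positivity
  linarith

theorem tendsto_zero_of_frobSq {a b : ℕ} {ι : Type*} {l : Filter ι}
    {X : ι → Matrix (Fin a) (Fin b) ℝ} (h : Tendsto (fun t => frobSq (X t)) l (𝓝 0)) :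
    Tendsto X l (𝓝 0) := by
  refine tendsto_pi_nhds.2 fun i => tendsto_pi_nhds.2 fun j => ?_
  have h2 : Tendsto (fun t => X t i j ^ 2) l (𝓝 0) :=
    squeeze_zero (fun _ => sq_nonneg _) (fun t => sq_apply_le_frobSq (X t) i j) h
  have h3 := h2.sqrt
  simp only [Real.sqrt_sq_eq_abs, Real.sqrt_zero] at h3
  exact (tendsto_zero_iff_abs_tendsto_zero _).2 h3

theorem continuous_frobSq {a b : ℕ} :
    Continuous (frobSq : Matrix (Fin a) (Fin b) ℝ → ℝ) := by
  unfold frobSq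
  exact continuous_finsetSum _ fun i _ => continuous_finsetSum _ fun j _ =>
    (continuous_id.matrix_elem i j).pow 2

/-! ### Second order expansions of the augmented Lagrangian -/

/-- A quadratic polynomial with zero constant term that is nonnegative everywhere has no linear
term. -/
theorem linear_coeff_eq_zero {b q : ℝ} (h : ∀ s : ℝ, 0 ≤ s * b + s ^ 2 * q) : b = 0 := by
  by_contra hb
  have hq : 0 < |q| + 1 := by positivity
  -- For `b ≠ 0` the polynomial is negative at this point, since `q < |q| + 1`.
  have h1 := h (-b / (|q| + 1))
  have : -b / (|q| + 1) * b + (-b / (|q| + 1)) ^ 2 * q =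
      (b ^ 2 / (|q| + 1) ^ 2) * (q - |q| - 1) := by
    field_simp; ring
  rw [this] at h1
  have h2 : 0 < b ^ 2 / (|q| + 1) ^ 2 := by positivity
  nlinarith [le_abs_self q]

theorem sum_sq_add_mul {ι : Type*} (T : Finset ι) (x y : ι → ℝ) (s : ℝ) :
    ∑ e ∈ T, (x e + s * y e) ^ 2 =
      ∑ e ∈ T, x e ^ 2 + s * ∑ e ∈ T, 2 * (x e * y e) + s ^ 2 * ∑ e ∈ T, y e ^ 2 := by
  rw [Finset.mul_sum, Finset.mul_sum, ← Finset.sum_add_distrib, ← Finset.sum_add_distrib]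
  exact Finset.sum_congr rfl fun _ _ => by ring

section Expansion

variable (Ω : Finset (Fin n × Fin m)) (A : Matrix (Fin n) (Fin m) ℝ)
  (Y : Matrix (Fin n) (Fin d) ℝ) (lam gam ρ₁ ρ₂ : ℝ)
  (U : Matrix (Fin n) (Fin k) ℝ) (V : Matrix (Fin m) (Fin k) ℝ)
  (P : Matrix (Fin n) (Fin n) ℝ) (Z Φ Ψ : Matrix (Fin n) (Fin k) ℝ)

/-- The directional derivative of the augmented Lagrangian in `U`, in the direction `H`. -/
noncomputable def dirDerivU (H : Matrix (Fin n) (Fin k) ℝ) : ℝ :=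
  ∑ e ∈ Ω, 2 * (((U * Vᵀ) e.1 e.2 - A e.1 e.2) * (H * Vᵀ) e.1 e.2)
    + gam * (Uᵀ * H).trace - (Ψᵀ * H).trace - ρ₂ * ((Z - U)ᵀ * H).trace

/-- The directional derivative of the augmented Lagrangian in `V`, in the direction `H`. -/
noncomputable def dirDerivV (H : Matrix (Fin m) (Fin k) ℝ) : ℝ :=
  ∑ e ∈ Ω, 2 * (((U * Vᵀ) e.1 e.2 - A e.1 e.2) * (U * Hᵀ) e.1 e.2) + gam * (Vᵀ * H).trace

/-- The directional derivative of the augmented Lagrangian in `Z`, in the direction `K`. -/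
noncomputable def dirDerivZ (K : Matrix (Fin n) (Fin k) ℝ) : ℝ :=
  (Φᵀ * (1 - P) * K).trace + (Ψᵀ * K).trace
    + ρ₁ * (((1 - P) * Z)ᵀ * ((1 - P) * K)).trace + ρ₂ * ((Z - U)ᵀ * K).trace

theorem augLagrangian_expand_U (H : Matrix (Fin n) (Fin k) ℝ) (s : ℝ) :
    augLagrangian Ω A Y lam gam ρ₁ ρ₂ (U + s • H) V P Z Φ Ψ =
      augLagrangian Ω A Y lam gam ρ₁ ρ₂ U V P Z Φ Ψ + s * dirDerivU Ω A gam ρ₂ U V Z Ψ H +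
      s ^ 2 * (∑ e ∈ Ω, (H * Vᵀ) e.1 e.2 ^ 2 + gam / 2 * frobSq H + ρ₂ / 2 * frobSq H) := by
  have h1 : ∑ e ∈ Ω, (((U + s • H) * Vᵀ) e.1 e.2 - A e.1 e.2) ^ 2 =
      ∑ e ∈ Ω, (((U * Vᵀ) e.1 e.2 - A e.1 e.2) + s * (H * Vᵀ) e.1 e.2) ^ 2 := by
    refine Finset.sum_congr rfl fun e _ => ?_
    simp only [Matrix.add_mul, Matrix.smul_mul, Matrix.add_apply, Matrix.smul_apply, smul_eq_mul]
    ring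
  have h2 : Z - (U + s • H) = (Z - U) + (-s) • H := by rw [neg_smul]; abel
  unfold augLagrangian dirDerivU
  rw [h1, sum_sq_add_mul, h2]
  simp only [frobSq_add_smul, Matrix.mul_add, trace_add, Matrix.mul_smul, trace_smul, smul_eq_mul]
  ring

theorem augLagrangian_expand_VZ (H : Matrix (Fin m) (Fin k) ℝ) (K : Matrix (Fin n) (Fin k) ℝ)
    (s : ℝ) :
    augLagrangian Ω A Y lam gam ρ₁ ρ₂ U (V + s • H) P (Z + s • K) Φ Ψ =
      augLagrangian Ω A Y lam gam ρ₁ ρ₂ U V P Z Φ Ψ +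
      s * (dirDerivV Ω A gam U V H + dirDerivZ ρ₁ ρ₂ U P Z Φ Ψ K) +
      s ^ 2 * (∑ e ∈ Ω, (U * Hᵀ) e.1 e.2 ^ 2 + gam / 2 * frobSq H +
        ρ₁ / 2 * frobSq ((1 - P) * K) + ρ₂ / 2 * frobSq K) := by
  have h1 : ∑ e ∈ Ω, ((U * (V + s • H)ᵀ) e.1 e.2 - A e.1 e.2) ^ 2 =
      ∑ e ∈ Ω, (((U * Vᵀ) e.1 e.2 - A e.1 e.2) + s * (U * Hᵀ) e.1 e.2) ^ 2 := by
    refine Finset.sum_congr rfl fun e _ => ?_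
    simp only [transpose_add, transpose_smul, Matrix.mul_add, Matrix.mul_smul, Matrix.add_apply,
      Matrix.smul_apply, smul_eq_mul]
    ring
  have h2 : Z + s • K - U = (Z - U) + s • K := by abel
  have h3 : (1 - P) * (Z + s • K) = (1 - P) * Z + s • ((1 - P) * K) := by
    rw [Matrix.mul_add, Matrix.mul_smul]
  unfold augLagrangian dirDerivV dirDerivZ
  rw [h1, sum_sq_add_mul, h2, h3]
  rw [Matrix.mul_add (Φᵀ * (1 - P)) Z]
  simp only [frobSq_add_smul, Matrix.mul_add Ψᵀ, trace_add, Matrix.mul_smul, trace_smul,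
    smul_eq_mul]
  ring

/-- The amount that the multiplier update adds to the augmented Lagrangian. -/
theorem augLagrangian_dual_step (r₁ r₂ : ℝ) :
    augLagrangian Ω A Y lam gam ρ₁ ρ₂ U V P Z (Φ + r₁ • ((1 - P) * Z)) (Ψ + r₂ • (Z - U)) =
      augLagrangian Ω A Y lam gam ρ₁ ρ₂ U V P Z Φ Ψ +
        r₁ * frobSq ((1 - P) * Z) + r₂ * frobSq (Z - U) := by
  unfold augLagrangian
  simp only [Matrix.mul_assoc]
  simp only [transpose_add Φ, transpose_add Ψ, transpose_smul, Matrix.add_mul Φᵀ,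
    Matrix.add_mul Ψᵀ, Matrix.smul_mul, trace_add, trace_smul, smul_eq_mul, frobSq_eq_trace]
  ring

/-- For bounded multipliers the augmented Lagrangian is bounded below, because the penalty terms
absorb the multiplier terms. -/
theorem augLagrangian_lower_bound (hlam : 0 < lam) (hgam : 0 < gam) (hρ₁ : 0 < ρ₁) (hρ₂ : 0 < ρ₂)
    (hP : P ∈ projSet n k) :
    -(frobSq Φ / (2 * ρ₁)) - frobSq Ψ / (2 * ρ₂) ≤
      augLagrangian Ω A Y lam gam ρ₁ ρ₂ U V P Z Φ Ψ := by
  obtain ⟨hP1, hP2, -⟩ := hP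
  have hY : (Yᵀ * (1 - P) * Y).trace = frobSq ((1 - P) * Y) := by
    rw [frobSq_eq_trace, transpose_mul, transpose_sub, transpose_one, hP1]
    have : (1 - P) * (1 - P) = 1 - P := by simp [mul_sub, sub_mul, hP2]
    rw [Matrix.mul_assoc, Matrix.mul_assoc, ← Matrix.mul_assoc (1 - P) (1 - P), this]
  have h1 := neg_frobSq_div_le Φ ((1 - P) * Z) hρ₁
  have h2 := neg_frobSq_div_le Ψ (Z - U) hρ₂
  have h3 : 0 ≤ ∑ e ∈ Ω, ((U * Vᵀ) e.1 e.2 - A e.1 e.2) ^ 2 :=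
    Finset.sum_nonneg fun _ _ => sq_nonneg _
  have h4 := frobSq_nonneg U
  have h5 := frobSq_nonneg V
  have h6 := mul_nonneg hlam.le (frobSq_nonneg ((1 - P) * Y))
  have h7 : 0 ≤ gam / 2 * (frobSq U + frobSq V) := by positivity
  unfold augLagrangian
  rw [hY, Matrix.mul_assoc Φᵀ]
  linarith

end Expansion

/-! ### Descent and passage to the limit -/

/-- If a sequence bounded below decreases by `q t` up to a summable error at each step,
then `q` tends to zero. -/
theorem tendsto_zero_of_descent {a q e : ℕ → ℝ} {b : ℝ} (hb : ∀ t, b ≤ a t) (hq : ∀ t, 0 ≤ q t)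
    (he0 : ∀ t, 0 ≤ e t) (he : Summable e) (h : ∀ t, a (t + 1) + q t ≤ a t + e t) :
    Tendsto q atTop (𝓝 0) := by
  have key : ∀ N, ∑ t ∈ Finset.range N, q t + a N ≤ a 0 + ∑ t ∈ Finset.range N, e t := by
    intro N
    induction N with
    | zero => simp
    | succ N ih =>
      rw [Finset.sum_range_succ, Finset.sum_range_succ]
      linarith [h N]
  refine (summable_of_sum_range_le (c := a 0 - b + ∑' t, e t) hq fun N => ?_).tendsto_atTop_zero
  linarith [key N, hb N, he.sum_le_tsum (Finset.range N) fun t _ => he0 t]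

theorem isClosed_projSet (n k : ℕ) : IsClosed (projSet n k) := by
  have h : projSet n k = {P | Pᵀ = P} ∩ ({P | P * P = P} ∩ {P | P.trace ≤ (k : ℝ)}) := rfl
  rw [h]
  refine (isClosed_eq ?_ ?_).inter ((isClosed_eq ?_ ?_).inter (isClosed_le ?_ ?_)) <;> fun_prop

/-- The part of the augmented Lagrangian that depends on `P`. -/
noncomputable def projObjective (Y : Matrix (Fin n) (Fin d) ℝ) (lam ρ₁ : ℝ)
    (P : Matrix (Fin n) (Fin n) ℝ) (Z Φ : Matrix (Fin n) (Fin k) ℝ) : ℝ :=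
  lam * (Yᵀ * (1 - P) * Y).trace + (Φᵀ * (1 - P) * Z).trace + ρ₁ / 2 * frobSq ((1 - P) * Z)

theorem continuous_dirDerivU (Ω : Finset (Fin n × Fin m)) (A : Matrix (Fin n) (Fin m) ℝ)
    (gam ρ₂ : ℝ) (H : Matrix (Fin n) (Fin k) ℝ) :
    Continuous fun x : Matrix (Fin n) (Fin k) ℝ × Matrix (Fin m) (Fin k) ℝ ×
      Matrix (Fin n) (Fin k) ℝ × Matrix (Fin n) (Fin k) ℝ =>
      dirDerivU Ω A gam ρ₂ x.1 x.2.1 x.2.2.1 x.2.2.2 H := by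
  unfold dirDerivU
  refine ((Continuous.add (continuous_finsetSum _ fun e _ => ?_) ?_).sub ?_).sub ?_
  · have h1 : Continuous fun x : Matrix (Fin n) (Fin k) ℝ × Matrix (Fin m) (Fin k) ℝ ×
        Matrix (Fin n) (Fin k) ℝ × Matrix (Fin n) (Fin k) ℝ => x.1 * x.2.1ᵀ := by fun_prop
    have h2 : Continuous fun x : Matrix (Fin n) (Fin k) ℝ × Matrix (Fin m) (Fin k) ℝ ×
        Matrix (Fin n) (Fin k) ℝ × Matrix (Fin n) (Fin k) ℝ => H * x.2.1ᵀ := by fun_prop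
    exact (((h1.matrix_elem _ _).sub continuous_const).mul (h2.matrix_elem _ _)).const_mul 2
  all_goals fun_prop

theorem continuous_dirDerivV (Ω : Finset (Fin n × Fin m)) (A : Matrix (Fin n) (Fin m) ℝ)
    (gam : ℝ) (H : Matrix (Fin m) (Fin k) ℝ) :
    Continuous fun x : Matrix (Fin n) (Fin k) ℝ × Matrix (Fin m) (Fin k) ℝ =>
      dirDerivV Ω A gam x.1 x.2 H := by
  unfold dirDerivV
  refine Continuous.add (continuous_finsetSum _ fun e _ => ?_) ?_
  · have h1 : Continuous fun x : Matrix (Fin n) (Fin k) ℝ × Matrix (Fin m) (Fin k) ℝ =>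
        x.1 * x.2ᵀ := by fun_prop
    have h2 : Continuous fun x : Matrix (Fin n) (Fin k) ℝ × Matrix (Fin m) (Fin k) ℝ =>
        x.1 * Hᵀ := by fun_prop
    exact (((h1.matrix_elem _ _).sub continuous_const).mul (h2.matrix_elem _ _)).const_mul 2
  · fun_prop

theorem continuous_dirDerivZ (ρ₁ ρ₂ : ℝ) (K : Matrix (Fin n) (Fin k) ℝ) :
    Continuous fun x : Matrix (Fin n) (Fin k) ℝ × Matrix (Fin n) (Fin n) ℝ ×
      Matrix (Fin n) (Fin k) ℝ × Matrix (Fin n) (Fin k) ℝ × Matrix (Fin n) (Fin k) ℝ =>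
      dirDerivZ ρ₁ ρ₂ x.1 x.2.1 x.2.2.1 x.2.2.2.1 x.2.2.2.2 K := by
  unfold dirDerivZ
  refine ((Continuous.add ?_ ?_).add ?_).add ?_ <;> fun_prop

theorem continuous_projObjective (Y : Matrix (Fin n) (Fin d) ℝ) (lam ρ₁ : ℝ) :
    Continuous fun x : Matrix (Fin n) (Fin n) ℝ × Matrix (Fin n) (Fin k) ℝ ×
      Matrix (Fin n) (Fin k) ℝ => projObjective Y lam ρ₁ x.1 x.2.1 x.2.2 := by
  unfold projObjective
  refine (Continuous.add ?_ ?_).add (Continuous.const_mul (continuous_frobSq.comp ?_) _) <;>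
    fun_prop

section Run

variable {Ω : Finset (Fin n × Fin m)} {A : Matrix (Fin n) (Fin m) ℝ}
  {Y : Matrix (Fin n) (Fin d) ℝ} {lam gam ρ₁ ρ₂ : ℝ}
  {U : ℕ → Matrix (Fin n) (Fin k) ℝ} {V : ℕ → Matrix (Fin m) (Fin k) ℝ}
  {P : ℕ → Matrix (Fin n) (Fin n) ℝ} {Z Φ Ψ : ℕ → Matrix (Fin n) (Fin k) ℝ}

theorem IsRun.dirDerivU_eq_zero (h : IsRun Ω A Y lam gam ρ₁ ρ₂ U V P Z Φ Ψ) (t : ℕ)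
    (H : Matrix (Fin n) (Fin k) ℝ) :
    dirDerivU Ω A gam ρ₂ (U (t + 1)) (V t) (Z t) (Ψ t) H = 0 := by
  refine linear_coeff_eq_zero (q := ∑ e ∈ Ω, (H * (V t)ᵀ) e.1 e.2 ^ 2 + gam / 2 * frobSq H +
    ρ₂ / 2 * frobSq H) fun s => ?_
  have h1 := (h.step_UP t).2 (U (t + 1) + s • H) _ (h.step_UP t).1
  rw [augLagrangian_expand_U] at h1
  linarith

theorem IsRun.dirDerivV_add_dirDerivZ_eq_zero (h : IsRun Ω A Y lam gam ρ₁ ρ₂ U V P Z Φ Ψ) (t : ℕ)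
    (H : Matrix (Fin m) (Fin k) ℝ) (K : Matrix (Fin n) (Fin k) ℝ) :
    dirDerivV Ω A gam (U (t + 1)) (V (t + 1)) H +
      dirDerivZ ρ₁ ρ₂ (U (t + 1)) (P (t + 1)) (Z (t + 1)) (Φ t) (Ψ t) K = 0 := by
  refine linear_coeff_eq_zero (q := ∑ e ∈ Ω, (U (t + 1) * Hᵀ) e.1 e.2 ^ 2 + gam / 2 * frobSq H +
    ρ₁ / 2 * frobSq ((1 - P (t + 1)) * K) + ρ₂ / 2 * frobSq K) fun s => ?_
  have h1 := h.step_VZ t (V (t + 1) + s • H) (Z (t + 1) + s • K)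
  rw [augLagrangian_expand_VZ] at h1
  linarith

theorem IsRun.dirDerivV_eq_zero (h : IsRun Ω A Y lam gam ρ₁ ρ₂ U V P Z Φ Ψ) (t : ℕ)
    (H : Matrix (Fin m) (Fin k) ℝ) :
    dirDerivV Ω A gam (U (t + 1)) (V (t + 1)) H = 0 := by
  simpa [dirDerivZ] using h.dirDerivV_add_dirDerivZ_eq_zero t H 0

theorem IsRun.dirDerivZ_eq_zero (h : IsRun Ω A Y lam gam ρ₁ ρ₂ U V P Z Φ Ψ) (t : ℕ)
    (K : Matrix (Fin n) (Fin k) ℝ) :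
    dirDerivZ ρ₁ ρ₂ (U (t + 1)) (P (t + 1)) (Z (t + 1)) (Φ t) (Ψ t) K = 0 := by
  simpa [dirDerivV] using h.dirDerivV_add_dirDerivZ_eq_zero t 0 K

theorem IsRun.projObjective_le (h : IsRun Ω A Y lam gam ρ₁ ρ₂ U V P Z Φ Ψ) (t : ℕ)
    {P' : Matrix (Fin n) (Fin n) ℝ} (hP' : P' ∈ projSet n k) :
    projObjective Y lam ρ₁ (P (t + 1)) (Z t) (Φ t) ≤ projObjective Y lam ρ₁ P' (Z t) (Φ t) := by
  have h1 := (h.step_UP t).2 (U (t + 1)) P' hP'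
  unfold augLagrangian at h1
  unfold projObjective
  linarith

/-- The sufficient decrease of the augmented Lagrangian: each iteration lowers it by a multiple of
the squared length of the step in `(V, Z)`, up to what the dual update adds. -/
theorem IsRun.sufficient_decrease (h : IsRun Ω A Y lam gam ρ₁ ρ₂ U V P Z Φ Ψ)
    (hρ₁ : 0 < ρ₁) (hρ₂ : 0 < ρ₂) {t : ℕ} (hP : P t ∈ projSet n k) :
    augLagrangian Ω A Y lam gam ρ₁ ρ₂ (U (t + 1)) (V (t + 1)) (P (t + 1)) (Z (t + 1))
        (Φ (t + 1)) (Ψ (t + 1)) +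
      (gam / 2 * frobSq (V (t + 1) - V t) + ρ₂ / 2 * frobSq (Z (t + 1) - Z t)) ≤
    augLagrangian Ω A Y lam gam ρ₁ ρ₂ (U t) (V t) (P t) (Z t) (Φ t) (Ψ t) +
      (1 / ρ₁ * frobSq (Φ (t + 1) - Φ t) + 1 / ρ₂ * frobSq (Ψ (t + 1) - Ψ t)) := by
  have h1 := (h.step_UP t).2 (U t) (P t) hP
  have h2 := augLagrangian_expand_VZ Ω A Y lam gam ρ₁ ρ₂ (U (t + 1)) (V (t + 1)) (P (t + 1))
    (Z (t + 1)) (Φ t) (Ψ t) (V t - V (t + 1)) (Z t - Z (t + 1)) 1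
  rw [h.dirDerivV_add_dirDerivZ_eq_zero, one_smul, one_smul, add_sub_cancel, add_sub_cancel,
    frobSq_sub_comm (V t), frobSq_sub_comm (Z t)] at h2
  have h3 : 0 ≤ ∑ e ∈ Ω, (U (t + 1) * (V t - V (t + 1))ᵀ) e.1 e.2 ^ 2 :=
    Finset.sum_nonneg fun _ _ => sq_nonneg _
  have h4 : 0 ≤ ρ₁ / 2 * frobSq ((1 - P (t + 1)) * (Z t - Z (t + 1))) :=
    mul_nonneg (by positivity) (frobSq_nonneg _)
  have h5 := augLagrangian_dual_step Ω A Y lam gam ρ₁ ρ₂ (U (t + 1)) (V (t + 1)) (P (t + 1))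
    (Z (t + 1)) (Φ t) (Ψ t) ρ₁ ρ₂
  rw [← h.step_Φ, ← h.step_Ψ] at h5
  have h6 : 1 / ρ₁ * frobSq (Φ (t + 1) - Φ t) = ρ₁ * frobSq ((1 - P (t + 1)) * Z (t + 1)) := by
    rw [h.step_Φ, add_sub_cancel_left, frobSq_smul]; field_simp
  have h7 : 1 / ρ₂ * frobSq (Ψ (t + 1) - Ψ t) = ρ₂ * frobSq (Z (t + 1) - U (t + 1)) := by
    rw [h.step_Ψ, add_sub_cancel_left, frobSq_smul]; field_simp
  linarith

theorem tendsto_dual_diff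
    (hsum : Summable fun t => frobSq (Φ (t + 1) - Φ t) + frobSq (Ψ (t + 1) - Ψ t)) :
    Tendsto (fun t => Φ (t + 1) - Φ t) atTop (𝓝 0) ∧
      Tendsto (fun t => Ψ (t + 1) - Ψ t) atTop (𝓝 0) := by
  constructor
  · exact tendsto_zero_of_frobSq <| squeeze_zero (fun _ => frobSq_nonneg _)
      (fun _ => le_add_of_nonneg_right (frobSq_nonneg _)) hsum.tendsto_atTop_zero
  · exact tendsto_zero_of_frobSq <| squeeze_zero (fun _ => frobSq_nonneg _)
      (fun _ => le_add_of_nonneg_left (frobSq_nonneg _)) hsum.tendsto_atTop_zero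

/-- Successive `V` and `Z` iterates become asymptotically equal. This is what lets the subproblem
optimality conditions, which mix iterates of two consecutive steps, pass to the limit. -/
theorem IsRun.tendsto_primal_diff (h : IsRun Ω A Y lam gam ρ₁ ρ₂ U V P Z Φ Ψ)
    (hlam : 0 < lam) (hgam : 0 < gam) (hρ₁ : 0 < ρ₁) (hρ₂ : 0 < ρ₂)
    (hbdd : ∃ c : ℝ, ∀ t, frobSq (Φ t) ≤ c ∧ frobSq (Ψ t) ≤ c)
    (hsum : Summable fun t => frobSq (Φ (t + 1) - Φ t) + frobSq (Ψ (t + 1) - Ψ t)) :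
    Tendsto (fun t => V (t + 1) - V t) atTop (𝓝 0) ∧
      Tendsto (fun t => Z (t + 1) - Z t) atTop (𝓝 0) := by
  obtain ⟨c, hc⟩ := hbdd
  have hsΦ : Summable fun t => frobSq (Φ (t + 1) - Φ t) :=
    hsum.of_nonneg_of_le (fun _ => frobSq_nonneg _)
      fun _ => le_add_of_nonneg_right (frobSq_nonneg _)
  have hsΨ : Summable fun t => frobSq (Ψ (t + 1) - Ψ t) :=
    hsum.of_nonneg_of_le (fun _ => frobSq_nonneg _)
      fun _ => le_add_of_nonneg_left (frobSq_nonneg _)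
  have hs := (hsΦ.mul_left (1 / ρ₁)).add (hsΨ.mul_left (1 / ρ₂))
  have nn : ∀ {a b : ℕ} (r : ℝ) (X : Matrix (Fin a) (Fin b) ℝ), 0 < r → 0 ≤ r * frobSq X :=
    fun r X hr => mul_nonneg hr.le (frobSq_nonneg X)
  -- `P t` lies in the constraint set by the minimization step for `t ≥ 1`, so the descent is
  -- followed from `t = 1` on.
  have key := tendsto_zero_of_descent
    (a := fun t => augLagrangian Ω A Y lam gam ρ₁ ρ₂ (U (t + 1)) (V (t + 1)) (P (t + 1))
      (Z (t + 1)) (Φ (t + 1)) (Ψ (t + 1)))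
    (q := fun t => gam / 2 * frobSq (V (t + 1 + 1) - V (t + 1)) +
      ρ₂ / 2 * frobSq (Z (t + 1 + 1) - Z (t + 1)))
    (e := fun t => 1 / ρ₁ * frobSq (Φ (t + 1 + 1) - Φ (t + 1)) +
      1 / ρ₂ * frobSq (Ψ (t + 1 + 1) - Ψ (t + 1)))
    (b := -(c / (2 * ρ₁)) - c / (2 * ρ₂))
    (fun t => le_trans (by have := hc (t + 1); gcongr <;> tauto)
      (augLagrangian_lower_bound Ω A Y lam gam ρ₁ ρ₂ _ _ _ _ _ _ hlam hgam hρ₁ hρ₂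
        (h.step_UP t).1))
    (fun t => add_nonneg (nn _ _ (by positivity)) (nn _ _ (by positivity)))
    (fun t => add_nonneg (nn _ _ (by positivity)) (nn _ _ (by positivity)))
    ((summable_nat_add_iff 1).2 hs)
    (fun t => h.sufficient_decrease hρ₁ hρ₂ (h.step_UP t).1)
  have key2 := (tendsto_add_atTop_iff_nat (f := fun t => gam / 2 * frobSq (V (t + 1) - V t) +
      ρ₂ / 2 * frobSq (Z (t + 1) - Z t)) 1).1 key
  constructor
  · refine tendsto_zero_of_frobSq (squeeze_zero (fun _ => frobSq_nonneg _) (fun t => ?_)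
      (by simpa using key2.const_mul (2 / gam)))
    have := nn (2 / gam * (ρ₂ / 2)) (Z (t + 1) - Z t) (by positivity)
    have e : 2 / gam * (gam / 2 * frobSq (V (t + 1) - V t)) = frobSq (V (t + 1) - V t) := by
      field_simp
    rw [mul_add, e]; linarith
  · refine tendsto_zero_of_frobSq (squeeze_zero (fun _ => frobSq_nonneg _) (fun t => ?_)
      (by simpa using key2.const_mul (2 / ρ₂)))
    have := nn (2 / ρ₂ * (gam / 2)) (V (t + 1) - V t) (by positivity)
    have e : 2 / ρ₂ * (ρ₂ / 2 * frobSq (Z (t + 1) - Z t)) = frobSq (Z (t + 1) - Z t) := by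
      field_simp
    rw [mul_add, e]; linarith

end Run

/-- If consecutive terms become close, the sequence and its shift have the same limit along any
filter finer than `atTop`. -/
theorem tendsto_pred_of_tendsto_diff {a b : ℕ} {X : ℕ → Matrix (Fin a) (Fin b) ℝ}
    {Xb : Matrix (Fin a) (Fin b) ℝ} {l : Filter ℕ} (hl : l ≤ atTop) (hX : Tendsto X l (𝓝 Xb))
    (hd : Tendsto (fun t => X (t + 1) - X t) atTop (𝓝 0)) :
    Tendsto (fun t => X (t - 1)) l (𝓝 Xb) := by
  have h1 : Tendsto (fun t => X (t - 1 + 1) - X (t - 1)) l (𝓝 0) :=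
    (hd.comp (tendsto_sub_atTop_nat 1)).mono_left hl
  have h2 := hX.sub h1
  rw [sub_zero] at h2
  refine h2.congr' ((eventually_ge_atTop 1).filter_mono hl |>.mono fun t ht => ?_)
  simp [Nat.sub_add_cancel ht]

/-- What the iteration forces at an accumulation point: feasibility, stationarity in `U`, `V`
and `Z`, and global optimality of `P` in its own subproblem. -/
theorem IsRun.stationary_of_mapClusterPt
    {Ω : Finset (Fin n × Fin m)} {A : Matrix (Fin n) (Fin m) ℝ}
    {Y : Matrix (Fin n) (Fin d) ℝ} {lam gam ρ₁ ρ₂ : ℝ}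
    {U : ℕ → Matrix (Fin n) (Fin k) ℝ} {V : ℕ → Matrix (Fin m) (Fin k) ℝ}
    {P : ℕ → Matrix (Fin n) (Fin n) ℝ} {Z Φ Ψ : ℕ → Matrix (Fin n) (Fin k) ℝ}
    (h : IsRun Ω A Y lam gam ρ₁ ρ₂ U V P Z Φ Ψ)
    (hlam : 0 < lam) (hgam : 0 < gam) (hρ₁ : 0 < ρ₁) (hρ₂ : 0 < ρ₂)
    (hbdd : ∃ c : ℝ, ∀ t, frobSq (Φ t) ≤ c ∧ frobSq (Ψ t) ≤ c)
    (hsum : Summable fun t => frobSq (Φ (t + 1) - Φ t) + frobSq (Ψ (t + 1) - Ψ t))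
    {Ub : Matrix (Fin n) (Fin k) ℝ} {Vb : Matrix (Fin m) (Fin k) ℝ}
    {Pb : Matrix (Fin n) (Fin n) ℝ} {Zb Φb Ψb : Matrix (Fin n) (Fin k) ℝ}
    (hacc : MapClusterPt (Ub, Vb, Pb, Zb, Φb, Ψb) atTop
      fun t => (U t, V t, P t, Z t, Φ t, Ψ t)) :
    Pb ∈ projSet n k ∧ (1 - Pb) * Zb = 0 ∧ Zb - Ub = 0 ∧
    (∀ H, dirDerivU Ω A gam ρ₂ Ub Vb Zb Ψb H = 0) ∧
    (∀ H, dirDerivV Ω A gam Ub Vb H = 0) ∧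
    (∀ K, dirDerivZ ρ₁ ρ₂ Ub Pb Zb Φb Ψb K = 0) ∧
    (∀ P' ∈ projSet n k, projObjective Y lam ρ₁ Pb Zb Φb ≤ projObjective Y lam ρ₁ P' Zb Φb) := by
  obtain ⟨l, hl, hlim⟩ := mapClusterPt_iff_ultrafilter.1 hacc
  have hU : Tendsto U l (𝓝 Ub) := (continuous_fst.tendsto _).comp hlim
  have hlim := (continuous_snd.tendsto _).comp hlim
  have hV : Tendsto V l (𝓝 Vb) := (continuous_fst.tendsto _).comp hlim
  have hlim := (continuous_snd.tendsto _).comp hlim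
  have hP : Tendsto P l (𝓝 Pb) := (continuous_fst.tendsto _).comp hlim
  have hlim := (continuous_snd.tendsto _).comp hlim
  have hZ : Tendsto Z l (𝓝 Zb) := (continuous_fst.tendsto _).comp hlim
  have hlim := (continuous_snd.tendsto _).comp hlim
  have hΦ : Tendsto Φ l (𝓝 Φb) := (continuous_fst.tendsto _).comp hlim
  have hΨ : Tendsto Ψ l (𝓝 Ψb) := (continuous_snd.tendsto _).comp hlim
  obtain ⟨hdV, hdZ⟩ := h.tendsto_primal_diff hlam hgam hρ₁ hρ₂ hbdd hsum
  obtain ⟨hdΦ, hdΨ⟩ := tendsto_dual_diff hsum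
  have hV' := tendsto_pred_of_tendsto_diff hl hV hdV
  have hZ' := tendsto_pred_of_tendsto_diff hl hZ hdZ
  have hΦ' := tendsto_pred_of_tendsto_diff hl hΦ hdΦ
  have hΨ' := tendsto_pred_of_tendsto_diff hl hΨ hdΨ
  have hpos : ∀ᶠ t in (l : Filter ℕ), 1 ≤ t := (eventually_ge_atTop 1).filter_mono hl
  -- Relations between the iterates `t` and `t - 1` hold for `t ≥ 1`, hence eventually along `l`.
  have lim0 : ∀ {T : Type} [TopologicalSpace T] [T2Space T] {f : ℕ → T} {x y : T},
      Tendsto f l (𝓝 x) → (∀ t, f (t + 1) = y) → x = y := by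
    intro T _ _ f x y hf h0
    refine tendsto_nhds_unique (hf.congr' ?_) tendsto_const_nhds
    filter_upwards [hpos] with t ht
    obtain ⟨t, rfl⟩ := Nat.exists_eq_add_of_le' ht
    exact h0 t
  refine ⟨?_, ?_, ?_, fun H => ?_, fun H => ?_, fun K => ?_, fun P' hP' => ?_⟩
  · refine (isClosed_projSet n k).mem_of_tendsto hP ?_
    filter_upwards [hpos] with t ht
    obtain ⟨t, rfl⟩ := Nat.exists_eq_add_of_le' ht
    exact (h.step_UP t).1
  · have h1 : Tendsto (fun t => ρ₁ • ((1 - P t) * Z t) - (Φ t - Φ (t - 1))) l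
        (𝓝 (ρ₁ • ((1 - Pb) * Zb) - (Φb - Φb))) := by
      have hc : Continuous fun x : Matrix (Fin n) (Fin n) ℝ × Matrix (Fin n) (Fin k) ℝ =>
          (1 - x.1) * x.2 := by fun_prop
      exact (((hc.tendsto _).comp (hP.prodMk_nhds hZ)).const_smul ρ₁).sub (hΦ.sub hΦ')
    have h2 := lim0 h1 (y := 0) fun t => by simp [h.step_Φ t]
    simpa [hρ₁.ne'] using h2
  · have h1 : Tendsto (fun t => ρ₂ • (Z t - U t) - (Ψ t - Ψ (t - 1))) l
        (𝓝 (ρ₂ • (Zb - Ub) - (Ψb - Ψb))) :=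
      ((hZ.sub hU).const_smul ρ₂).sub (hΨ.sub hΨ')
    have h2 := lim0 h1 (y := 0) fun t => by simp [h.step_Ψ t]
    simpa [hρ₂.ne'] using h2
  · have hc := continuous_dirDerivU Ω A gam ρ₂ H
    exact lim0 ((hc.tendsto (Ub, Vb, Zb, Ψb)).comp
      (hU.prodMk_nhds (hV'.prodMk_nhds (hZ'.prodMk_nhds hΨ')))) fun t => h.dirDerivU_eq_zero t H
  · have hc := continuous_dirDerivV Ω A gam H
    exact lim0 ((hc.tendsto (Ub, Vb)).comp (hU.prodMk_nhds hV)) fun t => h.dirDerivV_eq_zero t H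
  · have hc := continuous_dirDerivZ ρ₁ ρ₂ K
    exact lim0 ((hc.tendsto (Ub, Pb, Zb, Φb, Ψb)).comp
      (hU.prodMk_nhds (hP.prodMk_nhds (hZ.prodMk_nhds (hΦ'.prodMk_nhds hΨ')))))
      fun t => h.dirDerivZ_eq_zero t K
  · have hc := continuous_projObjective (k := k) Y lam ρ₁
    refine le_of_tendsto_of_tendsto
      ((hc.tendsto (Pb, Zb, Φb)).comp (hP.prodMk_nhds (hZ'.prodMk_nhds hΦ')))
      ((hc.tendsto (P', Zb, Φb)).comp
        ((tendsto_const_nhds (x := P')).prodMk_nhds (hZ'.prodMk_nhds hΦ'))) ?_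
    filter_upwards [hpos] with t ht
    obtain ⟨t, rfl⟩ := Nat.exists_eq_add_of_le' ht
    exact h.projObjective_le t hP'

/-! ### Orthogonal projections -/

section Projection

variable {P : Matrix (Fin n) (Fin n) ℝ}

/-- A projection and a symmetric matrix commuting with it admit an orthonormal basis, of the range
of the projection, of eigenvectors of that matrix. -/
theorem exists_eigenframe (hPs : Pᵀ = P) (hPi : P * P = P) {B : Matrix (Fin n) (Fin n) ℝ}
    (hB : Bᵀ = B) (hPB : P * B = B * P) :
    ∃ (r : ℕ) (N : Matrix (Fin n) (Fin r) ℝ) (τ : Fin r → ℝ),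
      Nᵀ * N = 1 ∧ B * N = N * diagonal τ ∧ N * Nᵀ = P := by
  let T := Matrix.toEuclideanLin B
  let R := LinearMap.range (Matrix.toEuclideanLin P)
  have hT : T.IsSymmetric := Matrix.isSymmetric_toEuclideanLin_iff.2 (by
    simpa [Matrix.IsHermitian, conjTranspose_eq_transpose_of_trivial] using hB)
  have hmem : ∀ v ∈ R, P *ᵥ v.ofLp = v.ofLp := by
    rintro _ ⟨w, rfl⟩
    simp [Matrix.toEuclideanLin, hPi]
  have hmem' : ∀ w : Fin n → ℝ, WithLp.toLp 2 (P *ᵥ w) ∈ R := fun w =>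
    ⟨WithLp.toLp 2 w, by simp [Matrix.toEuclideanLin]⟩
  have hinv : ∀ v ∈ R, T v ∈ R := by
    intro v hv
    have h1 : T v = WithLp.toLp 2 (P *ᵥ (B *ᵥ v.ofLp)) := by
      rw [mulVec_mulVec, hPB, ← mulVec_mulVec, hmem v hv]
      rfl
    rw [h1]
    exact hmem' _
  obtain ⟨r, b, τ, hb⟩ : ∃ (r : ℕ) (b : OrthonormalBasis (Fin r) ℝ R) (τ : Fin r → ℝ),
      ∀ i, T (b i) = τ i • (b i : EuclideanSpace ℝ (Fin n)) :=
    ⟨_, (hT.restrict_invariant hinv).eigenvectorBasis rfl,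
      (hT.restrict_invariant hinv).eigenvalues rfl, fun i =>
        congrArg Subtype.val ((hT.restrict_invariant hinv).apply_eigenvectorBasis rfl i)⟩
  let N : Matrix (Fin n) (Fin r) ℝ := Matrix.of fun a i => (b i : EuclideanSpace ℝ (Fin n)) a
  have hNN : Nᵀ * N = 1 := by
    ext i j
    have h1 := orthonormal_iff_ite.1 b.orthonormal i j
    rw [Submodule.coe_inner, PiLp.inner_apply] at h1
    rw [Matrix.one_apply, ← h1, Matrix.mul_apply]
    exact Finset.sum_congr rfl fun a _ => mul_comm _ _
  have hPN : P * N = N := by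
    ext a i
    exact congrFun (hmem _ (b i).2) a
  have hBN : B * N = N * diagonal τ := by
    ext a i
    rw [mul_diagonal]
    exact (congrArg (fun v : EuclideanSpace ℝ (Fin n) => v a) (hb i)).trans (mul_comm _ _)
  -- `N * Nᵀ` acts as the identity on the range of `P`: expand in the orthonormal basis `b`.
  have hspan : N * Nᵀ * P = P := by
    refine Matrix.ext_of_mulVec_single fun j => ?_
    rw [← mulVec_mulVec]
    set u := P *ᵥ Pi.single j 1
    have h1 := b.sum_repr' ⟨WithLp.toLp 2 u, hmem' _⟩
    ext a
    have h2 := congrArg (fun v : R => (v : EuclideanSpace ℝ (Fin n)) a) h1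
    refine Eq.trans ?_ h2
    rw [← mulVec_mulVec]
    simp only [AddSubmonoidClass.coe_finsetSum, SetLike.val_smul, WithLp.ofLp_sum, WithLp.ofLp_smul,
      Finset.sum_apply, Pi.smul_apply, smul_eq_mul, Submodule.coe_inner, PiLp.inner_apply]
    change ∑ i, N a i * ∑ c, N c i * u c = _
    refine Finset.sum_congr rfl fun i _ => ?_
    rw [mul_comm]
    refine congrArg₂ _ (Finset.sum_congr rfl fun c _ => ?_) rfl
    exact mul_comm _ _
  refine ⟨r, N, τ, hNN, hBN, ?_⟩
  calc N * Nᵀ = N * (P * N)ᵀ := by rw [hPN]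
    _ = P := by rw [transpose_mul, hPs, ← Matrix.mul_assoc, hspan]

theorem zero_le_dotProduct_self (x : Fin n → ℝ) : 0 ≤ x ⬝ᵥ x :=
  Finset.sum_nonneg fun _ _ => mul_self_nonneg _

theorem dotProduct_self_pos {x : Fin n → ℝ} (hx : x ≠ 0) : 0 < x ⬝ᵥ x :=
  (zero_le_dotProduct_self x).lt_of_ne' fun h => hx (dotProduct_self_eq_zero.1 h)

theorem trace_vecMulVec_mul (w : Fin n → ℝ) (C : Matrix (Fin n) (Fin n) ℝ) :
    (vecMulVec w w * C).trace = w ⬝ᵥ (C *ᵥ w) := by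
  rw [vecMulVec_mul, trace_vecMulVec, dotProduct_mulVec, dotProduct_comm]

theorem dotProduct_mulVec_comm {C : Matrix (Fin n) (Fin n) ℝ} (hC : Cᵀ = C) (x y : Fin n → ℝ) :
    x ⬝ᵥ (C *ᵥ y) = y ⬝ᵥ (C *ᵥ x) := by
  rw [dotProduct_mulVec, ← mulVec_transpose, hC, dotProduct_comm]

/-- Adjoining a line of the kernel to the range of a projection. -/
theorem projection_add (hPs : Pᵀ = P) (hPi : P * P = P) {w : Fin n → ℝ} (hw : w ≠ 0)
    (hPw : P *ᵥ w = 0) :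
    (P + (w ⬝ᵥ w)⁻¹ • vecMulVec w w)ᵀ = P + (w ⬝ᵥ w)⁻¹ • vecMulVec w w ∧
    (P + (w ⬝ᵥ w)⁻¹ • vecMulVec w w) * (P + (w ⬝ᵥ w)⁻¹ • vecMulVec w w) =
      P + (w ⬝ᵥ w)⁻¹ • vecMulVec w w ∧
    (P + (w ⬝ᵥ w)⁻¹ • vecMulVec w w).trace = P.trace + 1 := by
  have hww : w ⬝ᵥ w ≠ 0 := fun h => hw (dotProduct_self_eq_zero.1 h)
  have hwP : w ᵥ* P = 0 := by rw [← mulVec_transpose, hPs, hPw]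
  refine ⟨?_, ?_, ?_⟩
  · rw [transpose_add, transpose_smul, transpose_vecMulVec, hPs]
  · simp [Matrix.mul_add, Matrix.add_mul, hPi, mul_vecMulVec, vecMulVec_mul, hPw, hwP,
      add_mulVec, smul_mulVec, vecMulVec_mulVec, hww]
  · simp [trace_add, trace_smul, hww]

/-- Removing a line of the range from the range of a projection. -/
theorem projection_sub (hPs : Pᵀ = P) (hPi : P * P = P) {w : Fin n → ℝ} (hw : w ≠ 0)
    (hPw : P *ᵥ w = w) :
    (P - (w ⬝ᵥ w)⁻¹ • vecMulVec w w)ᵀ = P - (w ⬝ᵥ w)⁻¹ • vecMulVec w w ∧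
    (P - (w ⬝ᵥ w)⁻¹ • vecMulVec w w) * (P - (w ⬝ᵥ w)⁻¹ • vecMulVec w w) =
      P - (w ⬝ᵥ w)⁻¹ • vecMulVec w w ∧
    (P - (w ⬝ᵥ w)⁻¹ • vecMulVec w w).trace = P.trace - 1 := by
  have hww : w ⬝ᵥ w ≠ 0 := fun h => hw (dotProduct_self_eq_zero.1 h)
  have hwP : w ᵥ* P = w := by rw [← mulVec_transpose, hPs, hPw]
  refine ⟨?_, ?_, ?_⟩
  · rw [transpose_sub, transpose_smul, transpose_vecMulVec, hPs]
  · simp [Matrix.mul_sub, Matrix.sub_mul, hPi, mul_vecMulVec, vecMulVec_mul, hPw, hwP,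
      sub_mulVec, smul_mulVec, vecMulVec_mulVec, hww]
  · simp [trace_sub, trace_smul, hww]

end Projection

/-! ### Projections maximizing a linear functional -/

section Maximizer

variable {P C : Matrix (Fin n) (Fin n) ℝ}

/-- Exchanging the line of `x` in the range of a maximizing projection for the line of `z` does not
increase the Rayleigh quotient. -/
theorem rayleigh_exchange (hP : P ∈ projSet n k)
    (hmax : ∀ P' ∈ projSet n k, (P' * C).trace ≤ (P * C).trace)
    {x z : Fin n → ℝ} (hx : x ≠ 0) (hz : z ≠ 0) (hPx : P *ᵥ x = x)
    (hPz : (P - (x ⬝ᵥ x)⁻¹ • vecMulVec x x) *ᵥ z = 0) :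
    (z ⬝ᵥ (C *ᵥ z)) * (x ⬝ᵥ x) ≤ (x ⬝ᵥ (C *ᵥ x)) * (z ⬝ᵥ z) := by
  obtain ⟨hPs, hPi, hPt⟩ := hP
  obtain ⟨h1, h2, h3⟩ := projection_sub hPs hPi hx hPx
  obtain ⟨h4, h5, h6⟩ := projection_add h1 h2 hz hPz
  have h7 := hmax _ ⟨h4, h5, by rw [h6, h3]; linarith⟩
  simp only [Matrix.add_mul, Matrix.sub_mul, Matrix.smul_mul, trace_add, trace_sub, trace_smul,
    trace_vecMulVec_mul, smul_eq_mul] at h7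
  have hxx : 0 < x ⬝ᵥ x := dotProduct_self_pos hx
  have hzz : 0 < z ⬝ᵥ z := dotProduct_self_pos hz
  have h8 : (z ⬝ᵥ z)⁻¹ * (z ⬝ᵥ (C *ᵥ z)) ≤ (x ⬝ᵥ x)⁻¹ * (x ⬝ᵥ (C *ᵥ x)) := by linarith
  rw [inv_mul_eq_div, inv_mul_eq_div, div_le_div_iff₀ hzz hxx] at h8
  exact h8

/-- Rayleigh quotients of `C` on the kernel of a maximizing projection are at most those on its
range; the inequality is multiplied out to cover zero vectors. -/
theorem form_ker_le_form_range (hP : P ∈ projSet n k)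
    (hmax : ∀ P' ∈ projSet n k, (P' * C).trace ≤ (P * C).trace)
    {x y : Fin n → ℝ} (hPx : P *ᵥ x = x) (hPy : P *ᵥ y = 0) :
    (y ⬝ᵥ (C *ᵥ y)) * (x ⬝ᵥ x) ≤ (x ⬝ᵥ (C *ᵥ x)) * (y ⬝ᵥ y) := by
  rcases eq_or_ne x 0 with rfl | hx
  · simp
  rcases eq_or_ne y 0 with rfl | hy
  · simp
  refine rayleigh_exchange hP hmax hx hy hPx ?_
  have hxy : x ⬝ᵥ y = 0 := by
    rw [← hPx, dotProduct_comm, dotProduct_mulVec_comm hP.1, hPy, dotProduct_zero]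
  simp [sub_mulVec, smul_mulVec, vecMulVec_mulVec, hPy, hxy]

/-- First order optimality under rotations: the blocks of `C` between the range and the kernel of
a maximizing projection vanish. -/
theorem form_range_ker_eq_zero (hC : Cᵀ = C) (hP : P ∈ projSet n k)
    (hmax : ∀ P' ∈ projSet n k, (P' * C).trace ≤ (P * C).trace)
    {x y : Fin n → ℝ} (hPx : P *ᵥ x = x) (hPy : P *ᵥ y = 0) :
    x ⬝ᵥ (C *ᵥ y) = 0 := by
  rcases eq_or_ne x 0 with rfl | hx
  · simp
  have hxy : x ⬝ᵥ y = 0 := by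
    rw [← hPx, dotProduct_comm, dotProduct_mulVec_comm hP.1, hPy, dotProduct_zero]
  have hxx : x ⬝ᵥ x ≠ 0 := fun h => hx (dotProduct_self_eq_zero.1 h)
  -- Exchange `x` for the rotated vector `x + s • y` and read off the first order term in `s`.
  have key : -(2 * (x ⬝ᵥ (C *ᵥ y)) * (x ⬝ᵥ x)) = 0 := by
    refine linear_coeff_eq_zero (q := (x ⬝ᵥ (C *ᵥ x)) * (y ⬝ᵥ y) - (y ⬝ᵥ (C *ᵥ y)) * (x ⬝ᵥ x))
      fun s => ?_
    have hz : x + s • y ≠ 0 := by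
      intro h
      have h2 := congrArg (x ⬝ᵥ ·) h
      simp only [dotProduct_add, dotProduct_smul, hxy, dotProduct_zero, smul_zero, add_zero] at h2
      exact hxx h2
    have h1 := rayleigh_exchange hP hmax hx hz hPx (by
      simp [sub_mulVec, smul_mulVec, vecMulVec_mulVec, mulVec_add, mulVec_smul, hPx, hPy, hxy, hxx])
    simp only [mulVec_add, mulVec_smul, dotProduct_add, add_dotProduct, dotProduct_smul,
      smul_dotProduct, smul_eq_mul, hxy, dotProduct_comm y x, dotProduct_mulVec_comm hC y x] at h1
    linarith
  have : (x ⬝ᵥ (C *ᵥ y)) * (x ⬝ᵥ x) = 0 := by linarith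
  exact (mul_eq_zero.1 this).resolve_right hxx

theorem commute_of_maximizer (hC : Cᵀ = C) (hP : P ∈ projSet n k)
    (hmax : ∀ P' ∈ projSet n k, (P' * C).trace ≤ (P * C).trace) : P * C = C * P := by
  have h1 : P * (C * (1 - P)) = 0 := by
    ext i j
    have h2 := form_range_ker_eq_zero hC hP hmax (x := P *ᵥ Pi.single i 1)
      (y := (1 - P) *ᵥ Pi.single j 1) (by rw [mulVec_mulVec, hP.2.1])
      (by rw [mulVec_mulVec, mul_sub, mul_one, hP.2.1, sub_self, zero_mulVec])
    rw [dotProduct_comm, dotProduct_mulVec_comm hP.1, mulVec_mulVec, mulVec_mulVec] at h2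
    simpa [Matrix.mul_assoc] using h2
  have h3 : P * C = P * C * P := by
    rw [mul_sub, mul_sub, mul_one, sub_eq_zero] at h1
    rw [Matrix.mul_assoc, h1.symm]
  have h4 := congrArg transpose h3
  simp only [transpose_mul, hC, hP.1] at h4
  rw [h3, h4, Matrix.mul_assoc]

/-- If the trace constraint is slack, a line of the kernel can be added to a maximizing projection,
so the form of `C` is nonpositive there. -/
theorem form_ker_nonpos (hP : P ∈ projSet n k)
    (hmax : ∀ P' ∈ projSet n k, (P' * C).trace ≤ (P * C).trace) (ht : P.trace + 1 ≤ k)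
    {y : Fin n → ℝ} (hPy : P *ᵥ y = 0) : y ⬝ᵥ (C *ᵥ y) ≤ 0 := by
  rcases eq_or_ne y 0 with rfl | hy
  · simp
  obtain ⟨h4, h5, h6⟩ := projection_add hP.1 hP.2.1 hy hPy
  have h7 := hmax _ ⟨h4, h5, by rw [h6]; linarith⟩
  simp only [Matrix.add_mul, Matrix.smul_mul, trace_add, trace_smul,
    trace_vecMulVec_mul, smul_eq_mul] at h7
  have hyy : 0 < (y ⬝ᵥ y)⁻¹ :=
    inv_pos.2 (dotProduct_self_pos hy)
  by_contra! hpos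
  have := mul_pos hyy hpos
  linarith

end Maximizer

/-! ### Ky Fan's inequality -/

section KyFan

variable {B : Matrix (Fin n) (Fin n) ℝ} {M : Matrix (Fin n) (Fin k) ℝ} {σ : Fin k → ℝ}

theorem mulVec_col_dotProduct (hB : B * M = M * diagonal σ) (hM : Mᵀ * M = 1) (i : Fin k) :
    M.col i ⬝ᵥ M.col i = 1 ∧ B *ᵥ M.col i = σ i • M.col i := by
  constructor
  · have := congrFun (congrFun hM i) i
    rwa [one_apply_eq] at this
  · ext a
    have := congrFun (congrFun hB a) i
    rw [mul_diagonal, mul_comm] at this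
    exact this

theorem form_col (hB : B * M = M * diagonal σ) (hM : Mᵀ * M = 1) (i : Fin k) :
    M.col i ⬝ᵥ (B *ᵥ M.col i) = σ i := by
  obtain ⟨h1, h2⟩ := mulVec_col_dotProduct hB hM i
  rw [h2, dotProduct_smul, h1, smul_eq_mul, mul_one]

/-- A quadratic form is bounded by its values on leading eigenvectors and by a bound `s` on their
orthogonal complement. -/
theorem form_le_of_leading (hBs : Bᵀ = B) (hM : Mᵀ * M = 1) (hB : B * M = M * diagonal σ) {s : ℝ}
    (hs : ∀ x, Mᵀ *ᵥ x = 0 → x ⬝ᵥ (B *ᵥ x) ≤ s * (x ⬝ᵥ x)) (x : Fin n → ℝ) :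
    x ⬝ᵥ (B *ᵥ x) ≤ ∑ i, (σ i - s) * (M.col i ⬝ᵥ x) ^ 2 + s * (x ⬝ᵥ x) := by
  set c := Mᵀ *ᵥ x with hc
  set u := M *ᵥ c
  set y := x - u with hy
  have hMy : Mᵀ *ᵥ y = 0 := by
    rw [hy, mulVec_sub, mulVec_mulVec, hM, one_mulVec, sub_self]
  have hx : x = u + y := by rw [hy]; abel
  have huy : u ⬝ᵥ y = 0 := by
    rw [dotProduct_comm, dotProduct_mulVec, ← mulVec_transpose, hMy, zero_dotProduct]
  have hBu : B *ᵥ u = M *ᵥ (diagonal σ *ᵥ c) := by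
    rw [mulVec_mulVec, hB, ← mulVec_mulVec]
  have hyBu : y ⬝ᵥ (B *ᵥ u) = 0 := by
    rw [hBu, dotProduct_mulVec, ← mulVec_transpose, hMy, zero_dotProduct]
  have huBu : u ⬝ᵥ (B *ᵥ u) = ∑ i, σ i * c i ^ 2 := by
    rw [hBu, dotProduct_mulVec, ← mulVec_transpose, mulVec_mulVec, hM, one_mulVec]
    exact Finset.sum_congr rfl fun i _ => by rw [mulVec_diagonal]; ring
  have huu : u ⬝ᵥ u = ∑ i, c i ^ 2 := by
    rw [dotProduct_mulVec, ← mulVec_transpose, mulVec_mulVec, hM, one_mulVec]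
    exact Finset.sum_congr rfl fun i _ => by ring
  have h1 : x ⬝ᵥ (B *ᵥ x) = u ⬝ᵥ (B *ᵥ u) + y ⬝ᵥ (B *ᵥ y) := by
    rw [hx, mulVec_add, dotProduct_add, add_dotProduct, add_dotProduct,
      dotProduct_mulVec_comm hBs u y, hyBu]
    ring
  have h2 : x ⬝ᵥ x = u ⬝ᵥ u + y ⬝ᵥ y := by
    rw [hx, dotProduct_add, add_dotProduct, add_dotProduct, dotProduct_comm y u, huy]
    ring
  have h3 : ∑ i, (σ i - s) * (M.col i ⬝ᵥ x) ^ 2 = ∑ i, σ i * c i ^ 2 - s * ∑ i, c i ^ 2 := by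
    rw [Finset.mul_sum, ← Finset.sum_sub_distrib]
    refine Finset.sum_congr rfl fun i _ => ?_
    change (σ i - s) * c i ^ 2 = _
    ring
  rw [h1, h3, h2, huBu, huu]
  linarith [hs y hMy]

theorem dotProduct_projection_le {P : Matrix (Fin n) (Fin n) ℝ} (hPs : Pᵀ = P) (hPi : P * P = P)
    (x : Fin n → ℝ) : (P *ᵥ x) ⬝ᵥ (P *ᵥ x) ≤ x ⬝ᵥ x := by
  have h1 : x ⬝ᵥ (P *ᵥ x) = (P *ᵥ x) ⬝ᵥ (P *ᵥ x) := by
    rw [dotProduct_mulVec (P *ᵥ x), ← mulVec_transpose, hPs, mulVec_mulVec, hPi, dotProduct_comm]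
  have h2 := zero_le_dotProduct_self (x - P *ᵥ x)
  rw [dotProduct_sub, sub_dotProduct, sub_dotProduct, dotProduct_comm (P *ᵥ x) x, h1] at h2
  linarith

/-- Ky Fan's inequality: over the orthogonal projections of trace at most `k`, the trace of `P * B`
is at most the sum of `k` leading eigenvalues of `B`, if these are nonnegative. -/
theorem trace_mul_le_sum_of_leading (hBs : Bᵀ = B) (hM : Mᵀ * M = 1) (hB : B * M = M * diagonal σ)
    (hlead : ∀ i x, Mᵀ *ᵥ x = 0 → x ⬝ᵥ (B *ᵥ x) ≤ σ i * (x ⬝ᵥ x)) (hσ : ∀ i, 0 ≤ σ i)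
    {P : Matrix (Fin n) (Fin n) ℝ} (hP : P ∈ projSet n k) :
    (P * B).trace ≤ ∑ i, σ i := by
  obtain ⟨hPs, hPi, hPt⟩ := hP
  have hPtr : P.trace = frobSq P := by rw [frobSq_eq_trace, hPs, hPi]
  rcases Nat.eq_zero_or_pos k with rfl | hk
  · have hP0 : P = 0 := eq_zero_of_frobSq_eq_zero
      (le_antisymm (by rw [← hPtr]; simpa using hPt) (frobSq_nonneg P))
    simp [hP0]
  have : Nonempty (Fin k) := ⟨⟨0, hk⟩⟩
  -- The smallest leading eigenvalue bounds the form of `B` on the orthogonal complement.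
  obtain ⟨i₀, hi₀⟩ := Finite.exists_min σ
  have h1 : (P * B).trace = ∑ j, P.col j ⬝ᵥ (B *ᵥ P.col j) := by
    have : (P * B).trace = (Pᵀ * (B * P)).trace := by
      rw [hPs, trace_mul_comm P (B * P), Matrix.mul_assoc, hPi, trace_mul_comm]
    rw [this]
    rfl
  have h2 : ∑ j, P.col j ⬝ᵥ P.col j = P.trace := by
    have : ∑ j, P.col j ⬝ᵥ P.col j = (Pᵀ * P).trace := rfl
    rw [this, hPs, hPi]
  have h3 : ∀ i, ∑ j, (M.col i ⬝ᵥ P.col j) ^ 2 ≤ 1 := by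
    intro i
    have h4 := dotProduct_projection_le hPs hPi (M.col i)
    rw [(mulVec_col_dotProduct hB hM i).1] at h4
    refine le_trans (le_of_eq (Finset.sum_congr rfl fun j _ => ?_)) h4
    have h5 : (P *ᵥ M.col i) j = M.col i ⬝ᵥ P.col j := by
      conv_lhs => rw [← hPs]
      exact dotProduct_comm _ _
    rw [h5, sq]
  calc (P * B).trace
      ≤ ∑ j, (∑ i, (σ i - σ i₀) * (M.col i ⬝ᵥ P.col j) ^ 2 + σ i₀ * (P.col j ⬝ᵥ P.col j)) := by
        rw [h1]
        exact Finset.sum_le_sum fun j _ => form_le_of_leading hBs hM hB (hlead i₀) _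
    _ = ∑ i, (σ i - σ i₀) * ∑ j, (M.col i ⬝ᵥ P.col j) ^ 2 + σ i₀ * P.trace := by
        rw [Finset.sum_add_distrib, ← Finset.mul_sum, h2, Finset.sum_comm]
        simp only [Finset.mul_sum]
    _ ≤ ∑ i, (σ i - σ i₀) * 1 + σ i₀ * k := by
        refine add_le_add (Finset.sum_le_sum fun i _ => ?_) (mul_le_mul_of_nonneg_left hPt (hσ _))
        exact mul_le_mul_of_nonneg_left (h3 i) (sub_nonneg.2 (hi₀ i))
    _ = ∑ i, σ i := by
        simp [Finset.sum_sub_distrib]; ring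

theorem trace_mul_transpose_mul (hM : Mᵀ * M = 1) (hB : B * M = M * diagonal σ) :
    (M * Mᵀ * B).trace = ∑ i, σ i := by
  rw [Matrix.mul_assoc, trace_mul_comm, Matrix.mul_assoc, hB, ← Matrix.mul_assoc, hM,
    Matrix.one_mul, trace_diagonal]

end KyFan

/-! ### From spectral projections to truncated singular value decompositions -/

/-- A projection of trace at most `k` that commutes with `B`, dominates its kernel in the sense of
Rayleigh quotients of `B`, and kills `B` on its kernel if its trace is not `k`, comes from a
truncated singular value decomposition of `B`. If `k = n` the domination is void. -/
theorem exists_symTruncatedSVD {B P : Matrix (Fin n) (Fin n) ℝ} (hB : Bᵀ = B)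
    (hP : P ∈ projSet n k) (hkn : k ≤ n) (hPB : P * B = B * P)
    (hdom : k < n → ∀ x y, P *ᵥ x = x → P *ᵥ y = 0 →
      (y ⬝ᵥ (B *ᵥ y)) * (x ⬝ᵥ x) ≤ (x ⬝ᵥ (B *ᵥ x)) * (y ⬝ᵥ y))
    (hnonneg : ∀ y, P *ᵥ y = 0 → 0 ≤ y ⬝ᵥ (B *ᵥ y))
    (hker : P.trace + 1 ≤ k → ∀ y, P *ᵥ y = 0 → y ⬝ᵥ (B *ᵥ y) ≤ 0) :
    ∃ (M : Matrix (Fin n) (Fin k) ℝ) (σ : Fin k → ℝ) (S : Finset (Fin k)),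
      IsSymTruncatedSVD B M σ ∧ (∀ i, σ i ≠ 0 → i ∈ S) ∧
      P = M * diagonal (fun i => if i ∈ S then (1 : ℝ) else 0) * Mᵀ := by
  obtain ⟨hPs, hPi, hPt⟩ := hP
  obtain ⟨r, N, τ, hNN, hBN, hN⟩ := exists_eigenframe hPs hPi hB hPB
  obtain ⟨r', F, τ', hFF, hBF, hF⟩ := exists_eigenframe (P := 1 - P) (B := B)
    (by rw [transpose_sub, transpose_one, hPs]) (by simp [mul_sub, sub_mul, hPi]) hB
    (by rw [sub_mul, mul_sub, hPB, one_mul, mul_one])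
  have hr : P.trace = r := by
    rw [← hN, trace_mul_comm, hNN, trace_one, Fintype.card_fin]
  have hr' : (n : ℝ) - r = r' := by
    have h1 : (1 - P).trace = n - P.trace := by
      rw [trace_sub, trace_one, Fintype.card_fin]
    rw [← hr, ← h1, ← hF, trace_mul_comm, hFF, trace_one, Fintype.card_fin]
  have hrk : r ≤ k := by rw [hr] at hPt; exact_mod_cast hPt
  have hrn : n = r + r' := by
    have : (n : ℝ) = r + r' := by linarith
    exact_mod_cast this
  obtain ⟨q, rfl⟩ := Nat.exists_eq_add_of_le hrk
  have hq : q ≤ r' := by omega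
  have hPF : P * F = 0 := by
    calc P * F = P * (F * (Fᵀ * F)) := by rw [hFF, Matrix.mul_one]
      _ = P * (F * Fᵀ) * F := by simp only [Matrix.mul_assoc]
      _ = 0 := by rw [hF, mul_sub, mul_one, hPi, sub_self, Matrix.zero_mul]
  have hPN : P * N = N := by rw [← hN, Matrix.mul_assoc, hNN, Matrix.mul_one]
  have hNF : Nᵀ * F = 0 := by
    rw [← hPN, transpose_mul, hPs, Matrix.mul_assoc, hPF, Matrix.mul_zero]
  let F₀ : Matrix (Fin n) (Fin q) ℝ := F.submatrix id (Fin.castLE hq)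
  let M₀ : Matrix (Fin n) (Fin r ⊕ Fin q) ℝ := fromCols N F₀
  let σ₀ : Fin r ⊕ Fin q → ℝ := Sum.elim τ (τ' ∘ Fin.castLE hq)
  let e : Fin (r + q) ≃ Fin r ⊕ Fin q := finSumFinEquiv.symm
  have hF₀ : F₀ᵀ * F₀ = 1 := by
    have : F₀ᵀ * F₀ = (Fᵀ * F).submatrix (Fin.castLE hq) (Fin.castLE hq) := rfl
    rw [this, hFF, submatrix_one _ (Fin.castLE_injective hq)]
  have hNF₀ : Nᵀ * F₀ = 0 := by
    have : Nᵀ * F₀ = (Nᵀ * F).submatrix id (Fin.castLE hq) := rfl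
    rw [this, hNF, submatrix_zero]; rfl
  have hM₀ : M₀ᵀ * M₀ = 1 := by
    have hFN₀ : F₀ᵀ * N = 0 := by
      rw [← transpose_transpose (F₀ᵀ * N), transpose_mul, transpose_transpose, hNF₀, transpose_zero]
    simp only [M₀]
    rw [transpose_fromCols, fromRows_mul_fromCols, hNN, hNF₀, hFN₀, hF₀, fromBlocks_one]
  have hBM₀ : B * M₀ = M₀ * diagonal σ₀ := by
    ext a i
    rw [mul_diagonal]
    rcases i with i | i
    · have := congrFun (congrFun hBN a) i
      rw [mul_diagonal] at this
      exact this
    · have := congrFun (congrFun hBF a) (Fin.castLE hq i)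
      rw [mul_diagonal] at this
      exact this
  -- The columns of `M₀` taken from the kernel of `P` are present only if the trace of `P` is
  -- less than `k`, and then `B` vanishes on that kernel.
  have hdef : 0 < q → P.trace + 1 ≤ ((r + q : ℕ) : ℝ) := by
    intro h0
    rw [hr]
    exact_mod_cast Nat.add_le_add_left h0 r
  have hσ₀ : ∀ j : Fin q, σ₀ (Sum.inr j) = 0 := by
    intro j
    have h1 := form_col hBF hFF (Fin.castLE hq j)
    have h2 : P *ᵥ F.col (Fin.castLE hq j) = 0 := by
      ext a; exact congrFun (congrFun hPF a) _
    have h3 := hker (hdef j.pos) _ h2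
    have h4 := hnonneg _ h2
    rw [h1] at h3 h4
    exact le_antisymm h3 h4
  refine ⟨M₀.submatrix id e, σ₀ ∘ e, Finset.univ.filter fun i => (e i).isLeft = true,
    ⟨?_, ?_, ?_⟩, ?_, ?_⟩
  · have : (M₀.submatrix id e)ᵀ * M₀.submatrix id e = (M₀ᵀ * M₀).submatrix e e := rfl
    rw [this, hM₀, submatrix_one_equiv]
  · have h1 : B * M₀.submatrix id e = (B * M₀).submatrix id e := rfl
    rw [h1, hBM₀]
    ext a i
    simp [mul_diagonal]
  · intro i x hx
    have hx₀ : M₀ᵀ *ᵥ x = 0 := by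
      ext j
      have := congrFun hx (e.symm j)
      change ((M₀.submatrix id e).col (e.symm j)) ⬝ᵥ x = 0 at this
      have h2 : (M₀.submatrix id e).col (e.symm j) = M₀.col j := by
        ext a; simp [Matrix.col]
      rw [h2] at this
      exact this
    have hNx : Nᵀ *ᵥ x = 0 := by
      ext j; exact congrFun hx₀ (Sum.inl j)
    have hPx : P *ᵥ x = 0 := by rw [← hN, ← mulVec_mulVec, hNx, mulVec_zero]
    rw [abs_of_nonneg (hnonneg x hPx)]
    rcases lt_or_eq_of_le hkn with hlt | heq
    · change _ ≤ σ₀ (e i) * _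
      rcases e i with j | j
      · have h1 : P *ᵥ N.col j = N.col j := by
          ext a; exact congrFun (congrFun hPN a) j
        have h2 := hdom hlt _ _ h1 hPx
        rw [form_col hBN hNN, (mulVec_col_dotProduct hBN hNN j).1, mul_one] at h2
        exact h2
      · rw [hσ₀, zero_mul]
        exact hker (hdef j.pos) _ hPx
    · -- For `k = n` the orthogonal complement of the columns is trivial.
      have hx0 : x = 0 := by
        have hFx : Fᵀ *ᵥ x = 0 := by
          ext j
          exact congrFun hx₀ (Sum.inr ⟨j, by omega⟩)
        have h1 : (1 - P) *ᵥ x = 0 := by rw [← hF, ← mulVec_mulVec, hFx, mulVec_zero]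
        rwa [sub_mulVec, hPx, sub_zero, one_mulVec] at h1
      simp [hx0]
  · intro i hi
    rw [Finset.mem_filter]
    refine ⟨Finset.mem_univ _, ?_⟩
    change σ₀ (e i) ≠ 0 at hi
    rcases he : e i with j | j
    · rfl
    · rw [he] at hi
      exact absurd (hσ₀ j) hi
  · rw [← hN]
    ext a b
    rw [Matrix.mul_apply, Matrix.mul_apply]
    simp only [mul_diagonal, transpose_apply, submatrix_apply, id,
      Finset.mem_filter, Finset.mem_univ, true_and]
    rw [Equiv.sum_comp e fun i => M₀ a i * (if i.isLeft = true then (1 : ℝ) else 0) * M₀ b i]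
    simp [M₀]

/-! ### The dual matrix and the optimality conditions -/

theorem transpose_dualMatrix (Y : Matrix (Fin n) (Fin d) ℝ) (lam : ℝ)
    (Z Φ : Matrix (Fin n) (Fin k) ℝ) :
    (dualMatrix Y lam Z Φ)ᵀ = dualMatrix Y lam Z Φ := by
  simp [dualMatrix, transpose_mul, add_comm]

/-- On projections, the `P`-subproblem maximizes a linear functional. -/
theorem projObjective_eq (Y : Matrix (Fin n) (Fin d) ℝ) (lam ρ₁ : ℝ) {P : Matrix (Fin n) (Fin n) ℝ}
    (Z Φ : Matrix (Fin n) (Fin k) ℝ) (hPs : Pᵀ = P) (hPi : P * P = P) :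
    projObjective Y lam ρ₁ P Z Φ =
      lam * (Yᵀ * Y).trace + (Φᵀ * Z).trace + ρ₁ / 2 * (Zᵀ * Z).trace -
        (P * (dualMatrix Y lam Z Φ + (ρ₁ / 2) • (Z * Zᵀ))).trace := by
  have h1 : (1 - P) * (1 - P) = 1 - P := by simp [mul_sub, sub_mul, hPi]
  have h2 : frobSq ((1 - P) * Z) = (Zᵀ * Z).trace - (P * (Z * Zᵀ)).trace := by
    rw [frobSq_eq_trace, transpose_mul, transpose_sub, transpose_one, hPs, Matrix.mul_assoc,
      ← Matrix.mul_assoc (1 - P), h1, Matrix.sub_mul, Matrix.one_mul, Matrix.mul_sub, trace_sub,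
      trace_mul_comm Zᵀ (P * Z), Matrix.mul_assoc]
  have h3 : (Yᵀ * (1 - P) * Y).trace = (Yᵀ * Y).trace - (P * (Y * Yᵀ)).trace := by
    rw [Matrix.mul_sub, Matrix.sub_mul, Matrix.mul_one, trace_sub, trace_mul_cycle',
      trace_mul_comm, ← Matrix.mul_assoc]
  have h4 : (P * (Φ * Zᵀ)).trace = (P * (Z * Φᵀ)).trace := by
    rw [← trace_transpose, transpose_mul, transpose_mul, transpose_transpose, hPs, trace_mul_comm]
  have h5 : (Φᵀ * (1 - P) * Z).trace = (Φᵀ * Z).trace - (P * (Z * Φᵀ)).trace := by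
    rw [Matrix.mul_sub, Matrix.sub_mul, Matrix.mul_one, trace_sub, Matrix.mul_assoc,
      trace_mul_comm Φᵀ (P * Z), Matrix.mul_assoc]
  unfold projObjective dualMatrix
  rw [h2, h3, h5]
  simp only [Matrix.mul_add, Matrix.mul_smul, trace_add, trace_smul, smul_eq_mul, h4]
  ring

theorem mulVec_eq_zero_of_colSpace_eq {M₁ M₂ : Matrix (Fin n) (Fin k) ℝ}
    (h : colSpace M₁ = colSpace M₂) {x : Fin n → ℝ} (hx : M₁ᵀ *ᵥ x = 0) : M₂ᵀ *ᵥ x = 0 := by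
  have key : ∀ w ∈ colSpace M₁, w ⬝ᵥ x = 0 := by
    intro w hw
    induction hw using Submodule.span_induction with
    | mem w hw =>
      obtain ⟨i, rfl⟩ := hw
      exact congrFun hx i
    | zero => exact zero_dotProduct x
    | add u v _ _ hu hv => rw [add_dotProduct, hu, hv, add_zero]
    | smul c u _ hu => rw [smul_dotProduct, hu, smul_zero]
  ext i
  exact key _ (h ▸ Submodule.subset_span ⟨i, rfl⟩)

/-- As `Z * Zᵀ` is positive semidefinite of rank at most `k`, the orthogonal complement of `k`
leading eigenvectors lies in its kernel. -/
theorem transpose_mulVec_eq_zero_of_leading {Z M : Matrix (Fin n) (Fin k) ℝ}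
    (hM : IsLeadingEigenvectors (Z * Zᵀ) M) {x : Fin n → ℝ} (hx : Mᵀ *ᵥ x = 0) :
    Zᵀ *ᵥ x = 0 := by
  obtain ⟨hMM, τ, hτ, hlead⟩ := hM
  by_cases hpos : ∀ i, τ i ≠ 0
  · -- `Mᵀ * Z` has a right inverse, hence is invertible, so the columns of `M` span those of `Z`.
    set K : Matrix (Fin k) (Fin k) ℝ := Zᵀ * M * diagonal fun i => (τ i)⁻¹ with hK
    have h1 : Z * K = M := by
      have h2 : diagonal τ * (diagonal fun i => (τ i)⁻¹) = 1 := by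
        rw [diagonal_mul_diagonal, ← diagonal_one]
        congr 1
        ext i
        exact mul_inv_cancel₀ (hpos i)
      rw [hK, ← Matrix.mul_assoc, ← Matrix.mul_assoc, hτ, Matrix.mul_assoc, h2, Matrix.mul_one]
    have h3 : Mᵀ * Z * K = 1 := by rw [Matrix.mul_assoc, h1, hMM]
    have h4 : K * (Mᵀ * Z) = 1 := mul_eq_one_comm.1 h3
    have h5 : Z = M * (Mᵀ * Z) := by
      rw [← h1, Matrix.mul_assoc, h1, h4, Matrix.mul_one]
    rw [h5, transpose_mul, ← mulVec_mulVec, hx, mulVec_zero]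
  · push Not at hpos
    obtain ⟨i, hi⟩ := hpos
    have h1 := hlead i x hx
    rw [hi, zero_mul, ← mulVec_mulVec, dotProduct_mulVec, ← mulVec_transpose] at h1
    exact dotProduct_self_eq_zero.1 (le_antisymm h1 (zero_le_dotProduct_self _))

/-- On the kernel of `Zᵀ` the mixed terms of the dual matrix drop out, so its form reduces to
that of `lam • (Y * Yᵀ)`. -/
theorem form_dualMatrix_of_transpose_mulVec_eq_zero (Y : Matrix (Fin n) (Fin d) ℝ) (lam : ℝ)
    {Z : Matrix (Fin n) (Fin k) ℝ} (Φ : Matrix (Fin n) (Fin k) ℝ) {x : Fin n → ℝ}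
    (hx : Zᵀ *ᵥ x = 0) :
    x ⬝ᵥ (dualMatrix Y lam Z Φ *ᵥ x) = lam * ((Yᵀ *ᵥ x) ⬝ᵥ (Yᵀ *ᵥ x)) := by
  have h1 : x ⬝ᵥ (Z *ᵥ (Φᵀ *ᵥ x)) = 0 := by
    rw [dotProduct_mulVec, ← mulVec_transpose, hx, zero_dotProduct]
  have h2 : x ⬝ᵥ (Y *ᵥ (Yᵀ *ᵥ x)) = (Yᵀ *ᵥ x) ⬝ᵥ (Yᵀ *ᵥ x) := by
    rw [dotProduct_mulVec, ← mulVec_transpose]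
  simp only [dualMatrix, add_mulVec, smul_mulVec, dotProduct_add, dotProduct_smul, smul_eq_mul,
    ← mulVec_mulVec, hx, h1, h2, mulVec_zero, dotProduct_zero]
  ring

theorem exists_ne_zero_transpose_mulVec_eq_zero (hkn : k < n) (M : Matrix (Fin n) (Fin k) ℝ) :
    ∃ x : Fin n → ℝ, x ≠ 0 ∧ Mᵀ *ᵥ x = 0 := by
  have h := LinearMap.ker_ne_bot_of_finrank_lt (f := Mᵀ.mulVecLin) (by simpa using hkn)
  obtain ⟨x, hx, hx0⟩ := Submodule.exists_mem_ne_zero_of_ne_bot h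
  exact ⟨x, hx0, hx⟩

theorem le_of_transpose_mul_self_eq_one {M : Matrix (Fin n) (Fin k) ℝ} (h : Mᵀ * M = 1) :
    k ≤ n := by
  by_contra! hlt
  obtain ⟨x, hx, hx0⟩ := exists_ne_zero_transpose_mulVec_eq_zero hlt Mᵀ
  refine hx ?_
  rw [transpose_transpose] at hx0
  rw [← one_mulVec x, ← h, ← mulVec_mulVec, hx0, mulVec_zero]

/-- The optimality condition for `P`. Both `P` and the projection `Q` onto the common leading
eigenspace fix `Z`, so the penalty `Z * Zᵀ` in the `P`-subproblem does not distinguish them; hence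
`P` does as well as `Q` for the dual matrix `B` alone, which by Ky Fan's inequality makes `P` a
maximizer for `B` if `k < n`. If `k = n`, optimality for `B` plus the penalty is enough. -/
theorem cond_P_of_maximizer {Y : Matrix (Fin n) (Fin d) ℝ} {lam ρ₁ : ℝ} (hlam : 0 < lam)
    {P : Matrix (Fin n) (Fin n) ℝ} {Z Φ : Matrix (Fin n) (Fin k) ℝ} (hP : P ∈ projSet n k)
    (hPZ : P * Z = Z)
    (hmin : ∀ P' ∈ projSet n k, projObjective Y lam ρ₁ P Z Φ ≤ projObjective Y lam ρ₁ P' Z Φ)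
    (heig : ∃ M₁ M₂ : Matrix (Fin n) (Fin k) ℝ,
      IsLeadingEigenvectors (dualMatrix Y lam Z Φ) M₁ ∧ IsLeadingEigenvectors (Z * Zᵀ) M₂ ∧
      colSpace M₁ = colSpace M₂) :
    ∃ (M : Matrix (Fin n) (Fin k) ℝ) (σ : Fin k → ℝ) (S : Finset (Fin k)),
      IsSymTruncatedSVD (dualMatrix Y lam Z Φ) M σ ∧ (∀ i, σ i ≠ 0 → i ∈ S) ∧
      P = M * diagonal (fun i => if i ∈ S then (1 : ℝ) else 0) * Mᵀ := by
  obtain ⟨M, M₂, ⟨hMM, σ, hσ, hlead⟩, hM₂, hspan⟩ := heig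
  have hBs := transpose_dualMatrix Y lam Z Φ
  have hform := fun x => form_dualMatrix_of_transpose_mulVec_eq_zero Y lam (Z := Z) Φ (x := x)
  set B := dualMatrix Y lam Z Φ
  have hmax : ∀ P' ∈ projSet n k,
      (P' * (B + (ρ₁ / 2) • (Z * Zᵀ))).trace ≤ (P * (B + (ρ₁ / 2) • (Z * Zᵀ))).trace := by
    intro P' hP'
    have h := hmin P' hP'
    rw [projObjective_eq Y lam ρ₁ Z Φ hP.1 hP.2.1, projObjective_eq Y lam ρ₁ Z Φ hP'.1 hP'.2.1] at h
    linarith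
  have hCs : (B + (ρ₁ / 2) • (Z * Zᵀ))ᵀ = B + (ρ₁ / 2) • (Z * Zᵀ) := by
    rw [transpose_add, transpose_smul, transpose_mul, transpose_transpose, hBs]
  have hZP : Zᵀ * P = Zᵀ := by
    rw [← congrArg transpose hPZ, transpose_mul, hP.1, Matrix.mul_assoc, hP.2.1]
  have hkerZ : ∀ y, P *ᵥ y = 0 → Zᵀ *ᵥ y = 0 := fun y hy => by
    rw [← hZP, ← mulVec_mulVec, hy, mulVec_zero]
  have hkerM : ∀ x, Mᵀ *ᵥ x = 0 → Zᵀ *ᵥ x = 0 := fun x hx =>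
    transpose_mulVec_eq_zero_of_leading hM₂ (mulVec_eq_zero_of_colSpace_eq hspan hx)
  have hnonneg : ∀ x, Zᵀ *ᵥ x = 0 → 0 ≤ x ⬝ᵥ (B *ᵥ x) := fun x hx => by
    rw [hform x hx]
    exact mul_nonneg hlam.le (zero_le_dotProduct_self _)
  have hkn := le_of_transpose_mul_self_eq_one hMM
  rcases lt_or_eq_of_le hkn with hlt | heq
  · have hσ0 : ∀ i, 0 ≤ σ i := by
      intro i
      obtain ⟨x, hx, hMx⟩ := exists_ne_zero_transpose_mulVec_eq_zero hlt M
      have h1 := (hnonneg x (hkerM x hMx)).trans (hlead i x hMx)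
      exact nonneg_of_mul_nonneg_left h1 (dotProduct_self_pos hx)
    have hQZ : M * Mᵀ * Z = Z := by
      have h1 : Zᵀ * (1 - M * Mᵀ) = 0 := by
        refine Matrix.ext_of_mulVec_single fun j => ?_
        rw [← mulVec_mulVec, zero_mulVec]
        refine hkerM _ ?_
        rw [mulVec_mulVec, Matrix.mul_sub, Matrix.mul_one, ← Matrix.mul_assoc, hMM, Matrix.one_mul,
          sub_self, zero_mulVec]
      have h2 := congrArg transpose h1
      rw [transpose_mul, transpose_sub, transpose_one, transpose_mul, transpose_transpose,
        transpose_transpose, transpose_zero, Matrix.sub_mul, Matrix.one_mul, sub_eq_zero] at h2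
      exact h2.symm
    have hQ : M * Mᵀ ∈ projSet n k := by
      refine ⟨by rw [transpose_mul, transpose_transpose], ?_, ?_⟩
      · rw [Matrix.mul_assoc, ← Matrix.mul_assoc Mᵀ, hMM, Matrix.one_mul]
      · rw [trace_mul_comm, hMM, trace_one, Fintype.card_fin]
    -- `Q = M * Mᵀ` and `P` both fix `Z`, so the penalty terms cancel.
    have hQP : (M * Mᵀ * B).trace ≤ (P * B).trace := by
      have h1 := hmax _ hQ
      rw [Matrix.mul_add, Matrix.mul_add, Matrix.mul_smul, Matrix.mul_smul, ← Matrix.mul_assoc,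
        ← Matrix.mul_assoc P, hQZ, hPZ, trace_add, trace_add] at h1
      linarith
    have hmaxB : ∀ P' ∈ projSet n k, (P' * B).trace ≤ (P * B).trace := fun P' hP' =>
      (trace_mul_le_sum_of_leading hBs hMM hσ hlead hσ0 hP').trans
        ((trace_mul_transpose_mul hMM hσ).symm.trans_le hQP)
    exact exists_symTruncatedSVD hBs hP hkn (commute_of_maximizer hBs hP hmaxB)
      (fun _ x y hx hy => form_ker_le_form_range hP hmaxB hx hy)
      (fun y hy => hnonneg y (hkerZ y hy)) (fun ht y hy => form_ker_nonpos hP hmaxB ht hy)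
  · refine exists_symTruncatedSVD hBs hP hkn ?_ (fun h => absurd heq h.ne)
      (fun y hy => hnonneg y (hkerZ y hy)) (fun ht y hy => ?_)
    · have h1 := commute_of_maximizer hCs hP hmax
      rw [Matrix.mul_add, Matrix.add_mul, Matrix.mul_smul, Matrix.smul_mul, ← Matrix.mul_assoc, hPZ,
        Matrix.mul_assoc, hZP] at h1
      exact add_right_cancel h1
    · have h1 := form_ker_nonpos hP hmax ht hy
      rwa [add_mulVec, smul_mulVec, ← mulVec_mulVec, hkerZ y hy, mulVec_zero, smul_zero,
        add_zero] at h1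

theorem trace_transpose_mul_single {a b : ℕ} (X : Matrix (Fin a) (Fin b) ℝ) (i : Fin a)
    (j : Fin b) : (Xᵀ * Matrix.single i j (1 : ℝ)).trace = X i j := by
  rw [trace_mul_single]; simp

theorem transpose_mulVec_diagonal_mulVec {a b : ℕ} (X : Matrix (Fin a) (Fin b) ℝ) (w x : Fin a → ℝ)
    (l : Fin b) : (Xᵀ *ᵥ (diagonal w *ᵥ x)) l = ∑ j, X j l * (w j * x j) := by
  change ∑ j, X j l * (diagonal w *ᵥ x) j = _
  exact Finset.sum_congr rfl fun j _ => by rw [mulVec_diagonal]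

theorem cond_U_of_dirDerivU {Ω : Finset (Fin n × Fin m)} {A : Matrix (Fin n) (Fin m) ℝ}
    {gam ρ₂ : ℝ} {U : Matrix (Fin n) (Fin k) ℝ} {V : Matrix (Fin m) (Fin k) ℝ}
    {Ψ : Matrix (Fin n) (Fin k) ℝ} (h : ∀ H, dirDerivU Ω A gam ρ₂ U V U Ψ H = 0) (i : Fin n) :
    ((2 : ℝ) • (Vᵀ * rowMask Ω i * V) + gam • (1 : Matrix (Fin k) (Fin k) ℝ)) *ᵥ U.row i =
      (2 : ℝ) • ((Vᵀ * rowMask Ω i) *ᵥ A.row i) + Ψ.row i := by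
  ext l
  have h1 := h (Matrix.single i l 1)
  have h2 : ∑ e ∈ Ω, 2 * (((U * Vᵀ) e.1 e.2 - A e.1 e.2) *
      (Matrix.single i l (1 : ℝ) * Vᵀ) e.1 e.2) =
      2 * ∑ j, V j l * ((if (i, j) ∈ Ω then 1 else 0) * (U * Vᵀ) i j) -
      2 * ∑ j, V j l * ((if (i, j) ∈ Ω then 1 else 0) * A i j) := by
    rw [← Finset.univ_inter Ω, ← Finset.sum_ite_mem, Fintype.sum_prod_type,
      Finset.sum_eq_single i, Finset.mul_sum, Finset.mul_sum, ← Finset.sum_sub_distrib]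
    · refine Finset.sum_congr rfl fun j _ => ?_
      rw [Matrix.single_mul_apply_same, transpose_apply]
      simp only [Finset.univ_inter]
      split_ifs <;> ring
    · intro a _ ha
      refine Finset.sum_eq_zero fun j _ => ?_
      rw [Matrix.single_mul_apply_of_ne _ _ _ _ _ ha, mul_zero, mul_zero, ite_self]
    · simp
  unfold dirDerivU at h1
  rw [h2, trace_transpose_mul_single, trace_transpose_mul_single, sub_self] at h1
  have h3 : V *ᵥ U.row i = fun j => (U * Vᵀ) i j := by
    ext j; exact dotProduct_comm _ _
  simp only [add_mulVec, smul_mulVec, one_mulVec, ← mulVec_mulVec, rowMask, Pi.add_apply,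
    Pi.smul_apply, smul_eq_mul, h3, transpose_mulVec_diagonal_mulVec, Matrix.row_apply]
  simp only [transpose_zero, Matrix.zero_mul, trace_zero, mul_zero, sub_zero] at h1
  linarith

theorem cond_V_of_dirDerivV {Ω : Finset (Fin n × Fin m)} {A : Matrix (Fin n) (Fin m) ℝ}
    {gam : ℝ} {U : Matrix (Fin n) (Fin k) ℝ} {V : Matrix (Fin m) (Fin k) ℝ}
    (h : ∀ H, dirDerivV Ω A gam U V H = 0) (j : Fin m) :
    ((2 : ℝ) • (Uᵀ * colMask Ω j * U) + gam • (1 : Matrix (Fin k) (Fin k) ℝ)) *ᵥ V.row j =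
      (2 : ℝ) • ((Uᵀ * colMask Ω j) *ᵥ A.col j) := by
  ext l
  have h1 := h (Matrix.single j l 1)
  have h2 : ∑ e ∈ Ω, 2 * (((U * Vᵀ) e.1 e.2 - A e.1 e.2) *
      (U * (Matrix.single j l (1 : ℝ))ᵀ) e.1 e.2) =
      2 * ∑ i, U i l * ((if (i, j) ∈ Ω then 1 else 0) * (U * Vᵀ) i j) -
      2 * ∑ i, U i l * ((if (i, j) ∈ Ω then 1 else 0) * A i j) := by
    rw [transpose_single, ← Finset.univ_inter Ω, ← Finset.sum_ite_mem, Fintype.sum_prod_type_right,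
      Finset.sum_eq_single j, Finset.mul_sum, Finset.mul_sum, ← Finset.sum_sub_distrib]
    · refine Finset.sum_congr rfl fun i _ => ?_
      rw [Matrix.mul_single_apply_same]
      simp only [Finset.univ_inter]
      split_ifs <;> ring
    · intro b _ hb
      refine Finset.sum_eq_zero fun i _ => ?_
      rw [Matrix.mul_single_apply_of_ne _ _ _ _ _ hb, mul_zero, mul_zero, ite_self]
    · simp
  unfold dirDerivV at h1
  rw [h2, trace_transpose_mul_single] at h1
  have h3 : U *ᵥ V.row j = fun i => (U * Vᵀ) i j := rfl
  simp only [add_mulVec, smul_mulVec, one_mulVec, ← mulVec_mulVec, colMask, Pi.add_apply,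
    Pi.smul_apply, smul_eq_mul, h3, transpose_mulVec_diagonal_mulVec, Matrix.row_apply,
    Matrix.col_apply]
  linarith

theorem cond_Z_of_dirDerivZ {ρ₁ ρ₂ : ℝ} {U : Matrix (Fin n) (Fin k) ℝ}
    {P : Matrix (Fin n) (Fin n) ℝ} {Φ Ψ : Matrix (Fin n) (Fin k) ℝ} (hPs : Pᵀ = P)
    (hPU : (1 - P) * U = 0) (h : ∀ K, dirDerivZ ρ₁ ρ₂ U P U Φ Ψ K = 0) : Φ + Ψ = P * Φ := by
  have h1 : (1 - P) * Φ + Ψ = 0 := by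
    ext i l
    have h2 := h (Matrix.single i l 1)
    unfold dirDerivZ at h2
    have h3 : Φᵀ * (1 - P) = ((1 - P) * Φ)ᵀ := by
      rw [transpose_mul, transpose_sub, transpose_one, hPs]
    rw [h3, hPU, sub_self, trace_transpose_mul_single, trace_transpose_mul_single] at h2
    simpa using h2
  rw [Matrix.sub_mul, Matrix.one_mul] at h1
  rw [← sub_eq_zero, ← h1]
  abel

end MixedProjectionADMM

theorem mainTheorem1 {n m d k : ℕ} (Ω : Finset (Fin n × Fin m)) (A : Matrix (Fin n) (Fin m) ℝ)
    (Y : Matrix (Fin n) (Fin d) ℝ) (lam gam ρ₁ ρ₂ : ℝ)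
    (hlam : 0 < lam) (hgam : 0 < gam) (hρ₁ : 0 < ρ₁) (hρ₂ : 0 < ρ₂)
    (U : ℕ → Matrix (Fin n) (Fin k) ℝ) (V : ℕ → Matrix (Fin m) (Fin k) ℝ)
    (P : ℕ → Matrix (Fin n) (Fin n) ℝ) (Z Φ Ψ : ℕ → Matrix (Fin n) (Fin k) ℝ)
    (hrun : MixedProjectionADMM.IsRun Ω A Y lam gam ρ₁ ρ₂ U V P Z Φ Ψ)
    (hbdd : ∃ c : ℝ, ∀ t,
      MixedProjectionADMM.frobSq (Φ t) ≤ c ∧ MixedProjectionADMM.frobSq (Ψ t) ≤ c)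
    (hsum : Summable fun t => MixedProjectionADMM.frobSq (Φ (t + 1) - Φ t) +
      MixedProjectionADMM.frobSq (Ψ (t + 1) - Ψ t))
    (Ub : Matrix (Fin n) (Fin k) ℝ) (Vb : Matrix (Fin m) (Fin k) ℝ)
    (Pb : Matrix (Fin n) (Fin n) ℝ) (Zb Φb Ψb : Matrix (Fin n) (Fin k) ℝ)
    (hacc : MapClusterPt (Ub, Vb, Pb, Zb, Φb, Ψb) atTop
      fun t => (U t, V t, P t, Z t, Φ t, Ψ t))
    (heig : ∃ M₁ M₂ : Matrix (Fin n) (Fin k) ℝ,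
      MixedProjectionADMM.IsLeadingEigenvectors
        (MixedProjectionADMM.dualMatrix Y lam Zb Φb) M₁ ∧
      MixedProjectionADMM.IsLeadingEigenvectors (Zb * Zbᵀ) M₂ ∧
      MixedProjectionADMM.colSpace M₁ = MixedProjectionADMM.colSpace M₂) :
    MixedProjectionADMM.FirstOrderOptimal Ω A Y lam gam Ub Vb Pb Zb Φb Ψb := by
  obtain ⟨hP, hPZ, hZU, hdU, hdV, hdZ, hmin⟩ :=
    hrun.stationary_of_mapClusterPt hlam hgam hρ₁ hρ₂ hbdd hsum hacc
  obtain rfl : Zb = Ub := sub_eq_zero.1 hZU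
  have hPZ' : Pb * Zb = Zb := by
    rw [Matrix.sub_mul, Matrix.one_mul, sub_eq_zero] at hPZ
    exact hPZ.symm
  exact
    { cond_U := MixedProjectionADMM.cond_U_of_dirDerivU hdU
      cond_V := MixedProjectionADMM.cond_V_of_dirDerivV hdV
      cond_P := MixedProjectionADMM.cond_P_of_maximizer hlam hP hPZ' hmin heig
      cond_Z := MixedProjectionADMM.cond_Z_of_dirDerivZ hP.1 hPZ hdZ
      cond_Φ := hPZ'.symm
      cond_Ψ := rfl }
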